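/- All bigraphs are simple bipartite graphs with a fixed bipartition into partite sets $X,Y$. A mixed unit interval is an interval of length $1$ of the real line of one of the forms $[a,a+1]$, $(a,a+1)$, $[a,a+1)$, $(a,a+1]$. A mixed unit representation of a bigraph $B$ assigns to each vertex $v$ a mixed unit interval $I(v)$ such that two vertices are adjacent if and only if they lie in different partite sets and their intervals intersect; $B$ is a mixed unit interval bigraph if it has such a representation. A trivial modification of a representation of $B$ is a passage to another representation of $B$ by one of: a translation of the whole model; a reflection of the whole model about a point; a shift of some of the intervals by a common amount; a change of the types (open, closed, half-open) of some intervals with all end points kept; a permutation of the intervals among the vertices. $F_1$ is the tree on $x_0,x_1,x_2,x_3,y_0,y_1,y_2,y_3$ with edges $x_1y_0,x_1y_1,x_1y_2,x_1y_3,y_0x_0,y_1x_2,y_2x_3$. For integers $i,j\ge 1$ let $T'_{i,j}$ be the following bigraph. There is a vertex $x$ with neighbours $y$ and $y_0$; $y$ has degree $1$, and $y_0$ has exactly one further neighbour $x_0$, of degree $1$. There is a left path $q_1,\dots,q_i$ with $q_1$ adjacent to $x$, and a right path $s_1,\dots,s_j$ with $s_1$ adjacent to $x$. For $1\le k<i$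 there is a pendant vertex $p_k$ adjacent only to $q_k$, and for $1\le k<j$ a pendant vertex $r_k$ adjacent only to $s_k$. Write $z=q_i$ and $u=s_j$. The vertex $z$ has further neighbours $w_0,w_0'$, and $u$ has further neighbours $v',v_0,v_0'$, where $v'$ has degree $1$. The remaining edges are $w_0z_0,\ w_0z_0',\ w_0'z_0'$ and $v_0u_0,\ v_0u_0',\ v_0'u_0'$. The partite sets are given by the parity of the distance from $x$. The bigraph $T_{i,j}$ is obtained from $T'_{i,j}$ by adding one vertex $w'$ adjacent to $z$ only. Lemma 7. Let $i,j\ge 1$. (a) The following assignment is a mixed unit representation of $T'_{i,j}$: $$I(x)=[0,1],\quad I(x_0)=I(y_0)=(0,1),\quad I(y)=(-1,0],$$ $$I(q_k)=[-k,-k+1],\quad I(p_k)=(-k-1,-k],\quad I(s_k)=[k,k+1],\quad I(r_k)=[k,k+1),$$ $$I(v')=(j,j+1],\quad I(v_0)=[j+1,j+2],\quad I(v_0')=[j+1,j+2),\quad I(u_0)=[j+2,j+3],\quad I(u_0')=(j+1,j+2),$$ $$I(w_0)=[-i-1,-i],\quad I(w_0')=(-i-1,-i],\quad I(z_0)=[-i-2,-i-1],\quad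 I(z_0')=(-i-1,-i).$$ It is unique up to trivial modifications: every mixed unit representation of $T'_{i,j}$ is connected with it by a finite sequence of trivial modifications. Moreover it extends a representation of $F_1$: some induced copy of $F_1$ in $T'_{i,j}$ carries the intervals $[0,1]$ for $x_1$, $(0,1)$ for $x_0$ and $y_0$, $[-1,0]$ for $y_1$, $[-2,-1]$ for $x_2$, $[1,2]$ for $y_2$, $[2,3]$ for $x_3$ and $(-1,0]$ for $y_3$. (b) $T_{i,j}$ is a forbidden induced subgraph of mixed unit interval bigraphs: no mixed unit interval bigraph has an induced subgraph isomorphic to $T_{i,j}$. -/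

import Mathlib

universe u

/-- A bigraph: a simple graph together with a bipartition of its vertex set into the partite
sets `X` (side `true`) and `Y` (side `false`), every edge joining the two sides. -/
structure Bigraph (V : Type u) where
  graph : SimpleGraph V
  side : V → Bool
  side_ne : ∀ a b, graph.Adj a b → side a ≠ side b

/-- A unit interval of the real line with left end `left`, right end `left + 1`; the two flags say
whether the left and the right end belong to the interval. -/
@[ext]
structure MixedInterval where
  left : ℝ
  leftClosed : Bool
  rightClosed : Bool

namespace MixedInterval

/-- The set of points of a mixed unit interval. -/
def toSet (I : MixedInterval) : Set ℝ :=
  match I.leftClosed, I.rightClosed with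
  | true, true => Set.Icc I.left (I.left + 1)
  | true, false => Set.Ico I.left (I.left + 1)
  | false, true => Set.Ioc I.left (I.left + 1)
  | false, false => Set.Ioo I.left (I.left + 1)

/-- The unit interval `[a, a + 1]`. -/
def closed (a : ℝ) : MixedInterval := ⟨a, true, true⟩

/-- The unit interval `(a, a + 1)`. -/
def opened (a : ℝ) : MixedInterval := ⟨a, false, false⟩

/-- The unit interval `[a, a + 1)`. -/
def closedOpen (a : ℝ) : MixedInterval := ⟨a, true, false⟩

/-- The unit interval `(a, a + 1]`. -/
def openClosed (a : ℝ) : MixedInterval := ⟨a, false, true⟩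

/-- Two intervals meet if they have a common point. -/
def Meets (I J : MixedInterval) : Prop := (I.toSet ∩ J.toSet).Nonempty

/-- The interval moved by `d`, its type being kept. -/
def shift (d : ℝ) (I : MixedInterval) : MixedInterval :=
  ⟨I.left + d, I.leftClosed, I.rightClosed⟩

/-- The mirror image of the interval under the reflection `t ↦ 2 * c - t` about the point `c`. -/
def reflect (c : ℝ) (I : MixedInterval) : MixedInterval :=
  ⟨2 * c - (I.left + 1), I.rightClosed, I.leftClosed⟩

end MixedInterval

namespace Bigraph

variable {V : Type u}

/-- `I` is an intersection representation of the bigraph `B` by mixed unit intervals: two vertices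
are adjacent exactly when they lie in different partite sets and their intervals intersect. -/
def IsRep (B : Bigraph V) (I : V → MixedInterval) : Prop :=
  ∀ a b, B.graph.Adj a b ↔ B.side a ≠ B.side b ∧ (I a).Meets (I b)

/-- `B` is a mixed unit interval bigraph. -/
def IsMixedUnitIntervalBigraph (B : Bigraph V) : Prop := ∃ I, B.IsRep I

/-- One trivial modification, leading from the representation `I` of `B` to the
representation `J` of `B`. -/
inductive TrivialMod (B : Bigraph V) (I J : V → MixedInterval) : Prop
  /-- Translation of the entire model. -/
  | translate (hI : B.IsRep I) (hJ : B.IsRep J) (d : ℝ)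
      (h : ∀ v, J v = (I v).shift d)
  /-- Reflection of the entire model about a point. -/
  | reflect (hI : B.IsRep I) (hJ : B.IsRep J) (c : ℝ)
      (h : ∀ v, J v = (I v).reflect c)
  /-- A shift of some intervals by a common amount, the other intervals staying in place. -/
  | shift (hI : B.IsRep I) (hJ : B.IsRep J) (S : Set V) (d : ℝ)
      (hS : ∀ v ∈ S, J v = (I v).shift d) (hS' : ∀ v ∉ S, J v = I v)
  /-- A change of the types (open, closed, open-closed, closed-open) of some intervals,
  all end points being kept. -/
  | retype (hI : B.IsRep I) (hJ : B.IsRep J)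
      (h : ∀ v, (J v).left = (I v).left)
  /-- A relabeling of the intervals. -/
  | relabel (hI : B.IsRep I) (hJ : B.IsRep J) (e : Equiv.Perm V)
      (h : ∀ v, J v = I (e v))

/-- `I` is a representation of `B`, and it is the only one up to trivial modifications: each
representation of `B` is connected with `I` by a finite chain of trivial modifications. -/
def IsUniqueRep (B : Bigraph V) (I : V → MixedInterval) : Prop :=
  B.IsRep I ∧ ∀ J, B.IsRep J → Relation.EqvGen B.TrivialMod I J

end Bigraph

/-! ### The bigraph `F₁` -/

/-- The vertices of `F₁`. -/
inductive F1Vertex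
  | x0 | x1 | x2 | x3 | y0 | y1 | y2 | y3

namespace F1Vertex

/-- The edges of `F₁`, each listed in one direction: three paths of length two and one pendant
vertex `y3` at the vertex `x1`. -/
def Edge : F1Vertex → F1Vertex → Prop
  | x1, y0 => True
  | x1, y1 => True
  | x1, y2 => True
  | x1, y3 => True
  | y0, x0 => True
  | y1, x2 => True
  | y2, x3 => True
  | _, _ => False

/-- The partite sets of `F₁`. -/
def side : F1Vertex → Bool
  | x0 | x1 | x2 | x3 => true
  | y0 | y1 | y2 | y3 => false

/-- The intervals representing `F₁`. -/
def interval : F1Vertex → MixedInterval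
  | x1 => .closed 0
  | x0 => .opened 0
  | y0 => .opened 0
  | y1 => .closed (-1)
  | x2 => .closed (-2)
  | y2 => .closed 1
  | x3 => .closed 2
  | y3 => .openClosed (-1)

end F1Vertex

/-- The bigraph `F₁`: the bipartite claw with a further pendant vertex at its centre. -/
def bigraphF1 : Bigraph F1Vertex where
  graph := SimpleGraph.fromRel F1Vertex.Edge
  side := F1Vertex.side
  side_ne := by
    intro a b h
    rw [SimpleGraph.fromRel_adj] at h
    cases a <;> cases b <;> simp_all [F1Vertex.Edge, F1Vertex.side]

/-! ### The bigraphs `T'_{i,j}` and `T_{i,j}` -/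

/-- The vertices of `T'_{i,j}` (for `i, j ≥ 1`).
* `left 0, …, left (i - 1)` is the path `y₁'', x₁'', y₂'', x₂'', …, z` with `i` vertices, and
  `leftPendant k` is the pendant vertex at `left k` (these are `x₁''', y₁''', x₂''', …`); there is
  none at `z`.
* `right 0, …, right (j - 1)` is the path `y₁, x₁, y₂, x₂, …, u` with `j` vertices, and
  `rightPendant k` is the pendant vertex at `right k` (these are `x₁', y₁', x₂', …`); the
  pendant vertex at `u` is `v'`. -/
inductive TVertex (i j : ℕ)
  | x | x0 | y | y0
  | left (k : Fin i)
  | leftPendant (k : Fin (i - 1))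
  | w0 | w0' | z0 | z0'
  | right (k : Fin j)
  | rightPendant (k : Fin (j - 1))
  | v' | v0 | v0' | u0 | u0'

namespace TVertex

variable {i j : ℕ}

/-- The edges of `T'_{i,j}`, each listed in one direction. -/
def Edge : TVertex i j → TVertex i j → Prop
  | x, y => True
  | x, y0 => True
  | y0, x0 => True
  | x, left k => k.val = 0
  | left k, left l => k.val + 1 = l.val
  | left k, leftPendant l => k.val = l.val
  | left k, w0 => k.val + 1 = i
  | left k, w0' => k.val + 1 = i
  | w0, z0 => True
  | w0, z0' => True
  | w0', z0' => True
  | x, right k => k.val = 0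
  | right k, right l => k.val + 1 = l.val
  | right k, rightPendant l => k.val = l.val
  | right k, v' => k.val + 1 = j
  | right k, v0 => k.val + 1 = j
  | right k, v0' => k.val + 1 = j
  | v0, u0 => True
  | v0, u0' => True
  | v0', u0' => True
  | _, _ => False

/-- The distance of a vertex from `x`. -/
def level : TVertex i j → ℕ
  | x => 0
  | y | y0 => 1
  | x0 => 2
  | left k => k + 1
  | leftPendant k => k + 2
  | w0 | w0' => i + 1
  | z0 | z0' => i + 2
  | right k => k + 1
  | rightPendant k => k + 2
  | v' | v0 | v0' => j + 1
  | u0 | u0' => j + 2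

/-- The partite sets: the vertices at even distance from `x` against those at odd distance. -/
def side (a : TVertex i j) : Bool := decide (Even a.level)

/-- The intervals representing `T'_{i,j}`. -/
def interval : TVertex i j → MixedInterval
  | x => .closed 0
  | x0 => .opened 0
  | y0 => .opened 0
  | y => .openClosed (-1)
  | left k => .closed (-((k : ℝ) + 1))
  | leftPendant k => .openClosed (-((k : ℝ) + 1) - 1)
  | w0 => .closed (-(i : ℝ) - 1)
  | w0' => .openClosed (-(i : ℝ) - 1)
  | z0 => .closed (-(i : ℝ) - 2)
  | z0' => .opened (-(i : ℝ) - 1)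
  | right k => .closed ((k : ℝ) + 1)
  | rightPendant k => .closedOpen ((k : ℝ) + 1)
  | v' => .openClosed (j : ℝ)
  | v0 => .closed ((j : ℝ) + 1)
  | v0' => .closedOpen ((j : ℝ) + 1)
  | u0 => .closed ((j : ℝ) + 2)
  | u0' => .opened ((j : ℝ) + 1)

theorem side_ne_of_edge {a b : TVertex i j} (h : Edge a b) : side a ≠ side b := by
  have key : b.level = a.level + 1 := by
    cases a <;> cases b <;> simp_all [Edge, level]
  simp only [side, key, ne_eq, decide_eq_decide]
  rw [Nat.even_add_one]
  tauto

end TVertex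

/-- The bigraph `T'_{i,j}`. -/
def bigraphT' (i j : ℕ) : Bigraph (TVertex i j) where
  graph := SimpleGraph.fromRel TVertex.Edge
  side := TVertex.side
  side_ne := by
    intro a b h
    rw [SimpleGraph.fromRel_adj] at h
    rcases h.2 with h | h
    · exact TVertex.side_ne_of_edge h
    · exact (TVertex.side_ne_of_edge h).symm

/-- The edges of `T_{i,j}`, each listed in one direction: those of `T'_{i,j}`, and an edge from
the last vertex `z` of the left path to the new vertex `w' = none`. -/
def TEdge {i j : ℕ} : Option (TVertex i j) → Option (TVertex i j) → Prop
  | some a, some b => TVertex.Edge a b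
  | some (TVertex.left k), none => k.val + 1 = i
  | _, _ => False

/-- The partite sets of `T_{i,j}`; the new vertex `w'` lies on the side of `w₀`. -/
def tSide {i j : ℕ} : Option (TVertex i j) → Bool
  | some a => a.side
  | none => TVertex.side (TVertex.w0 : TVertex i j)

/-- The bigraph `T_{i,j}`: `T'_{i,j}` with one more vertex `w'`, adjacent to `z` only. -/
def bigraphT (i j : ℕ) : Bigraph (Option (TVertex i j)) where
  graph := SimpleGraph.fromRel TEdge
  side := tSide
  side_ne := by
    have key : ∀ a b : Option (TVertex i j), TEdge a b → tSide a ≠ tSide b := by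
      intro a b h
      rcases a with _ | a <;> rcases b with _ | b
      · exact h.elim
      · exact h.elim
      · cases a with
        | left k => exact TVertex.side_ne_of_edge (a := TVertex.left k) (b := TVertex.w0) h
        | _ => exact h.elim
      · exact TVertex.side_ne_of_edge h
    intro a b h
    rw [SimpleGraph.fromRel_adj] at h
    rcases h.2 with h | h
    · exact key a b h
    · exact (key b a h).symm

/-! Uniqueness splits into two independent facts. (1) Two representations of a finite bigraph are
linked by trivial modifications as soon as all non-adjacent pairs from different partite sets occur
in the same order (`Bigraph.eqvGen_of_sameOrder`). Every requirement on such a pair bounds the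
difference of two left ends by 1, weakly, with equality governed by the types. Hence left ends may
slide up to halfway towards the other representation with the types unchanged. The two halfway
models have equal left ends and differ by a change of types. (2) Up to reflection, the order in
$T'_{i,j}$ is forced. Of the three arms of length two at $x$, the middle one has its end vertex
squeezed into the interior of $I(x)$, so every interval meeting that vertex meets $I(x)$; only the
arm $y_0x_0$ allows this (`TNode.Rep.normal_or`). From there the order spreads along induced
matchings (`MixedInterval.Prec.of_matching`). What remains is the side of $y$, whose interval starts
one unit to the right or to the left of $I(x)$. If it lies to the right, equalities of end points
propagate along the right arm and exclude a pendant vertex at its branching end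
(`TNode.Normal.right_end`); the mirror statement holds on the left. In $T'_{i,j}$ the vertex $v'$
therefore pushes $y$ to the left, and in $T_{i,j}$ the vertices $v'$ and $w'$ exclude both sides,
which is (b). -/

namespace MixedInterval

/-! ### Meeting and precedence in terms of left ends and types. -/

theorem mem_toSet (I : MixedInterval) (t : ℝ) :
    t ∈ I.toSet ↔ (I.left < t ∨ I.leftClosed = true ∧ t = I.left) ∧
      (t < I.left + 1 ∨ I.rightClosed = true ∧ t = I.left + 1) := by
  rcases I with ⟨a, _ | _, _ | _⟩ <;>
    simp [toSet, le_iff_lt_or_eq, eq_comm]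

theorem meets_iff (I K : MixedInterval) :
    I.Meets K ↔ (K.left < I.left + 1 ∧ I.left < K.left + 1) ∨
      (K.left = I.left + 1 ∧ I.rightClosed = true ∧ K.leftClosed = true) ∨
      (I.left = K.left + 1 ∧ K.rightClosed = true ∧ I.leftClosed = true) := by
  constructor
  · rintro ⟨t, h1, h2⟩
    rw [mem_toSet] at h1 h2
    obtain ⟨h1 | ⟨h1, h1'⟩, h3 | ⟨h3, h3'⟩⟩ := h1 <;>
    obtain ⟨h2 | ⟨h2, h2'⟩, h4 | ⟨h4, h4'⟩⟩ := h2 <;>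
    first
      | exact Or.inl ⟨by linarith, by linarith⟩
      | exact Or.inr (Or.inl ⟨by linarith, by assumption, by assumption⟩)
      | exact Or.inr (Or.inr ⟨by linarith, by assumption, by assumption⟩)
  · rintro (⟨h1, h2⟩ | ⟨h1, h2, h3⟩ | ⟨h1, h2, h3⟩)
    -- The midpoint of the overlap, interior to both intervals.
    · refine ⟨(I.left + K.left + 1) / 2, ?_, ?_⟩ <;> rw [mem_toSet] <;>
        exact ⟨Or.inl (by linarith), Or.inl (by linarith)⟩
    · refine ⟨K.left, ?_, ?_⟩ <;> rw [mem_toSet]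
      · exact ⟨Or.inl (by linarith), Or.inr ⟨h2, h1⟩⟩
      · exact ⟨Or.inr ⟨h3, rfl⟩, Or.inl (by linarith)⟩
    · refine ⟨I.left, ?_, ?_⟩ <;> rw [mem_toSet]
      · exact ⟨Or.inr ⟨h3, rfl⟩, Or.inl (by linarith)⟩
      · exact ⟨Or.inl (by linarith), Or.inr ⟨h2, h1⟩⟩

theorem meets_comm {I K : MixedInterval} : I.Meets K ↔ K.Meets I := by
  unfold Meets
  rw [Set.inter_comm]

theorem meets_reflect (c : ℝ) (I K : MixedInterval) :
    (I.reflect c).Meets (K.reflect c) ↔ I.Meets K := by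
  have e (a b : ℝ) : 2 * c - (b + 1) < 2 * c - (a + 1) + 1 ↔ a < b + 1 := by
    constructor <;> intro h <;> linarith
  have e' (a b : ℝ) : 2 * c - (b + 1) = 2 * c - (a + 1) + 1 ↔ a = b + 1 := by
    constructor <;> intro h <;> linarith
  simp only [meets_iff, reflect, e, e']
  tauto

/-- `I` lies to the left of `K`, the two intervals being disjoint. -/
def Prec (I K : MixedInterval) : Prop := I.left < K.left ∧ ¬ I.Meets K

theorem prec_iff (I K : MixedInterval) :
    I.Prec K ↔ I.left + 1 ≤ K.left ∧
      (K.left = I.left + 1 → I.rightClosed = true → K.leftClosed = true → False) := by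
  rw [Prec, meets_iff]
  constructor
  · rintro ⟨h1, h2⟩
    push Not at h2
    refine ⟨?_, fun h3 h4 h5 => ?_⟩
    · by_contra h
      exact absurd (h2.1 (by linarith)) (by linarith)
    · exact h2.2.1 h3 h4 h5
  · rintro ⟨h1, h2⟩
    refine ⟨by linarith, ?_⟩
    rintro (⟨h3, h4⟩ | ⟨h3, h4, h5⟩ | ⟨h3, h4, h5⟩)
    · linarith
    · exact h2 h3 h4 h5
    · linarith

theorem prec_or_prec {I K : MixedInterval} (h : ¬ I.Meets K) : I.Prec K ∨ K.Prec I := by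
  rcases lt_trichotomy I.left K.left with h1 | h1 | h1
  · exact Or.inl ⟨h1, h⟩
  · exact absurd ((meets_iff I K).2 (Or.inl ⟨by linarith, by linarith⟩)) h
  · exact Or.inr ⟨h1, fun h2 => h (meets_comm.1 h2)⟩

theorem prec_reflect (c : ℝ) (I K : MixedInterval) :
    (I.reflect c).Prec (K.reflect c) ↔ K.Prec I := by
  rw [Prec, Prec, meets_reflect, meets_comm]
  simp only [reflect]
  constructor <;> rintro ⟨h1, h2⟩ <;> exact ⟨by linarith, h2⟩

theorem Meets.le_left_add_one {I K : MixedInterval} (h : I.Meets K) :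
    K.left ≤ I.left + 1 := by
  rcases (meets_iff I K).1 h with h | h | h <;> linarith [h.1]

/-- In an induced matching of two edges `ab`, `cd`, the relative position of `a` and `c`
determines that of `b` and `d`. -/
theorem Prec.of_matching {a b c d : MixedInterval} (h : a.Prec c) (hab : a.Meets b)
    (hcd : c.Meets d) (hbd : ¬ b.Meets d) : b.Prec d := by
  refine (prec_or_prec hbd).resolve_right fun h' => ?_
  rw [prec_iff] at h h'
  -- In the opposite order, `b ≤ a + 1 ≤ c ≤ d + 1 ≤ b` for the left ends, so all are equalities.
  -- The contacts of `a`, `b` and of `d`, `c` then close exactly the ends at which `d` and `b`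
  -- touch.
  have h1 := hab.le_left_add_one
  have h2 := (meets_comm.1 hcd).le_left_add_one
  have h3 : b.left = a.left + 1 := by linarith
  have h4 : c.left = d.left + 1 := by linarith
  have h5 : b.left = d.left + 1 := by linarith
  have h6 : c.left = a.left + 1 := by linarith
  rw [meets_iff] at hab hcd
  have hab : a.rightClosed = true ∧ b.leftClosed = true := by
    rcases hab with h | h | h
    · linarith [h.1]
    · exact h.2
    · linarith [h.1]
  have hcd : d.rightClosed = true ∧ c.leftClosed = true := by
    rcases hcd with h | h | h
    · linarith [h.2]
    · linarith [h.1]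
    · exact h.2
  exact h'.2 h5 hcd.1 hab.2

end MixedInterval

/-! ### Representations with the same order are connected. -/

namespace Bigraph

variable {V : Type u} {B : Bigraph V}

theorem IsRep.reflect {I : V → MixedInterval} (h : B.IsRep I) (c : ℝ) :
    B.IsRep fun v => (I v).reflect c := by
  intro a b
  rw [MixedInterval.meets_reflect]
  exact h a b

/-- Two representations have the same order if any two vertices from different partite sets that
are not adjacent occur in the same order in both. -/
def SameOrder (B : Bigraph V) (I J : V → MixedInterval) : Prop :=
  ∀ a b, B.side a ≠ B.side b → ¬ B.graph.Adj a b → (I a).left < (I b).left →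
    (J a).left < (J b).left

/-- The differences of left ends may be moved from those of one representation towards those of
another one with the same order, the types being kept. -/
theorem IsRep.of_between {I J : V → MixedInterval} (hI : B.IsRep I) (hJ : B.IsRep J)
    (h : B.SameOrder I J) {K : V → MixedInterval}
    (hl : ∀ v, (K v).leftClosed = (I v).leftClosed)
    (hr : ∀ v, (K v).rightClosed = (I v).rightClosed)
    (hK : ∀ a b,
      ((I b).left - (I a).left ≤ (K b).left - (K a).left ∧
        2 * ((K b).left - (K a).left) ≤
          ((I b).left - (I a).left) + ((J b).left - (J a).left)) ∨
      ((K b).left - (K a).left ≤ (I b).left - (I a).left ∧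
        ((I b).left - (I a).left) + ((J b).left - (J a).left) ≤
          2 * ((K b).left - (K a).left))) :
    B.IsRep K := by
  intro a b
  by_cases hs : B.side a = B.side b
  · simp only [hs, ne_eq, not_true_eq_false, false_and, iff_false]
    exact fun hab => B.side_ne a b hab hs
  by_cases hab : B.graph.Adj a b
  · have h1 := ((hI a b).1 hab).2
    have h2 := ((hJ a b).1 hab).2
    simp only [hab, true_iff, ne_eq, hs, not_false_eq_true, true_and]
    have h3 := h2.le_left_add_one
    have h4 := (MixedInterval.meets_comm.1 h2).le_left_add_one
    rw [MixedInterval.meets_iff] at h1 ⊢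
    rw [hl, hl, hr, hr]
    -- The difference in `K` is an average in which `I` has weight at least one half. Strict overlap
    -- in `I` therefore persists, and a contact in `I` either stays a contact with the same types or
    -- becomes an overlap.
    rcases hK a b with ⟨hle, k⟩ | ⟨hle, k⟩
    · rcases h1 with h1 | ⟨h1, h1'⟩ | ⟨h1, h1'⟩
      · exact Or.inl ⟨by linarith [h1.1], by linarith [h1.2]⟩
      · exact Or.inr (Or.inl ⟨by linarith, h1'⟩)
      · rcases hle.eq_or_lt with he | hlt
        · exact Or.inr (Or.inr ⟨by linarith, h1'⟩)
        · exact Or.inl ⟨by linarith, by linarith⟩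
    · rcases h1 with h1 | ⟨h1, h1'⟩ | ⟨h1, h1'⟩
      · exact Or.inl ⟨by linarith [h1.1], by linarith [h1.2]⟩
      · rcases hle.eq_or_lt with he | hlt
        · exact Or.inr (Or.inl ⟨by linarith, h1'⟩)
        · exact Or.inl ⟨by linarith, by linarith⟩
      · exact Or.inr (Or.inr ⟨by linarith, h1'⟩)
  · have h1 : ¬ (I a).Meets (I b) := fun h1 => hab ((hI a b).2 ⟨hs, h1⟩)
    have h2 : ¬ (J a).Meets (J b) := fun h1 => hab ((hJ a b).2 ⟨hs, h1⟩)
    simp only [hab, false_iff, ne_eq, hs, not_false_eq_true, true_and]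
    rw [MixedInterval.meets_iff, hl, hl, hr, hr]
    -- The left ends are at least 1 apart in both `I` and `J`, in the same direction; distance
    -- exactly 1 in `K` forces distance exactly 1 in `I`, where the types already forbid contact.
    rcases MixedInterval.prec_or_prec h1 with h3 | h3
    · have h4 : (J a).Prec (J b) := ⟨h a b hs hab h3.1, h2⟩
      rw [MixedInterval.prec_iff] at h3 h4
      rintro (⟨h5, h6⟩ | ⟨h5, h6, h7⟩ | ⟨h5, h6, h7⟩)
      · rcases hK a b with ⟨hle, k⟩ | ⟨hle, k⟩
        · linarith
        · linarith
      · refine h3.2 ?_ h6 h7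
        rcases hK a b with ⟨hle, k⟩ | ⟨hle, k⟩
        · linarith
        · linarith
      · rcases hK a b with ⟨hle, k⟩ | ⟨hle, k⟩
        · linarith
        · linarith
    · have h4 : (J b).Prec (J a) :=
        ⟨h b a (Ne.symm hs) (fun h => hab h.symm) h3.1,
          fun h => h2 (MixedInterval.meets_comm.1 h)⟩
      rw [MixedInterval.prec_iff] at h3 h4
      rintro (⟨h5, h6⟩ | ⟨h5, h6, h7⟩ | ⟨h5, h6, h7⟩)
      · rcases hK a b with ⟨hle, k⟩ | ⟨hle, k⟩
        · linarith
        · linarith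
      · rcases hK a b with ⟨hle, k⟩ | ⟨hle, k⟩
        · linarith
        · linarith
      · refine h3.2 ?_ h6 h7
        rcases hK a b with ⟨hle, k⟩ | ⟨hle, k⟩
        · linarith
        · linarith

/-- A vector of displacements, cut off at a common value, can be realized by successive shifts. -/
theorem eqvGen_of_displacement [Finite V] {I : V → MixedInterval} (d : V → ℝ)
    (h : ∀ c : ℝ, B.IsRep fun v => (I v).shift (min (d v) c)) (c c' : ℝ) (hc : c ≤ c') :
    Relation.EqvGen B.TrivialMod (fun v => (I v).shift (min (d v) c))
      (fun v => (I v).shift (min (d v) c')) := by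
  have hfin (c c' : ℝ) : (Set.range d ∩ Set.Ioo c c').Finite :=
    (Set.finite_range d).inter_of_left _
  induction hn : (Set.range d ∩ Set.Ioo c c').ncard using Nat.strong_induction_on
    generalizing c c' with
  | _ n ih =>
    rcases (Set.range d ∩ Set.Ioo c c').eq_empty_or_nonempty with he | ⟨m, hm⟩
    -- With no displacement strictly between `c` and `c'`, raising the cutoff moves precisely the
    -- vertices with `c < d v`, all by `c' - c`.
    · refine .rel _ _ (.shift (h c) (h c') {v | c < d v} (c' - c) ?_ ?_)
      · intro v hv
        have : c' ≤ d v := by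
          by_contra hlt
          exact he.subset ⟨⟨v, rfl⟩, hv, not_le.1 hlt⟩
        have hv : c ≤ d v := le_of_lt hv
        simp only [MixedInterval.shift, min_eq_right this, min_eq_right hv,
          MixedInterval.mk.injEq, and_self, and_true]
        ring
      · intro v hv
        have hv : d v ≤ c := not_lt.1 hv
        simp only [min_eq_left hv, min_eq_left (hv.trans hc)]
    · have lt1 : (Set.range d ∩ Set.Ioo c m).ncard < n := by
        rw [← hn]
        refine Set.ncard_lt_ncard ⟨?_, fun hs => ?_⟩ (hfin c c')
        · exact fun t ht => ⟨ht.1, ht.2.1, ht.2.2.trans hm.2.2⟩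
        · exact lt_irrefl m (hs hm).2.2
      have lt2 : (Set.range d ∩ Set.Ioo m c').ncard < n := by
        rw [← hn]
        refine Set.ncard_lt_ncard ⟨?_, fun hs => ?_⟩ (hfin c c')
        · exact fun t ht => ⟨ht.1, hm.2.1.trans ht.2.1, ht.2.2⟩
        · exact lt_irrefl m (hs hm).2.1
      exact .trans _ _ _ (ih _ lt1 c m hm.2.1.le rfl) (ih _ lt2 m c' hm.2.2.le rfl)

/-- The representation with the left ends halfway between those of `I` and `J`, and the types
of `I`. -/
noncomputable def halfway (I J : V → MixedInterval) (v : V) : MixedInterval :=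
  (I v).shift (((J v).left - (I v).left) / 2)

theorem eqvGen_halfway [Finite V] {I J : V → MixedInterval} (hI : B.IsRep I) (hJ : B.IsRep J)
    (h : B.SameOrder I J) :
    Relation.EqvGen B.TrivialMod I (halfway I J) ∧ B.IsRep (halfway I J) := by
  set d : V → ℝ := fun v => ((J v).left - (I v).left) / 2 with hd
  have key (c : ℝ) : B.IsRep fun v => (I v).shift (min (d v) c) := by
    refine hI.of_between hJ h (fun v => rfl) (fun v => rfl) ?_
    intro a b
    -- Truncation is monotone and 1-Lipschitz, so the truncated displacements of two vertices differ
    -- by at most the full half-displacements do, in the same direction.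
    simp only [MixedInterval.shift, hd]
    rcases le_total (((J a).left - (I a).left) / 2) (((J b).left - (I b).left) / 2) with h0 | h0
    · left
      rcases min_cases (((J a).left - (I a).left) / 2) c with ⟨h1, h2⟩ | ⟨h1, h2⟩ <;>
      rcases min_cases (((J b).left - (I b).left) / 2) c with ⟨h3, h4⟩ | ⟨h3, h4⟩ <;>
      rw [h1, h3] <;> constructor <;> linarith
    · right
      rcases min_cases (((J a).left - (I a).left) / 2) c with ⟨h1, h2⟩ | ⟨h1, h2⟩ <;>
      rcases min_cases (((J b).left - (I b).left) / 2) c with ⟨h3, h4⟩ | ⟨h3, h4⟩ <;>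
      rw [h1, h3] <;> constructor <;> linarith
  obtain ⟨m, hm⟩ := (Set.finite_range d).bddBelow
  obtain ⟨M, hM⟩ := (Set.finite_range d).bddAbove
  -- Cutting at the lower bound `m` gives a translation, cutting at an upper bound gives the halfway
  -- model. The maximum keeps the cutoffs ordered even when `V` is empty.
  have eM : (fun v => (I v).shift (min (d v) (max m M))) = halfway I J := by
    funext v
    rw [min_eq_left ((hM ⟨v, rfl⟩).trans (le_max_right _ _))]
    rfl
  refine ⟨?_, eM ▸ key _⟩
  rw [← eM]
  refine .trans _ _ _ (.rel _ _ (.translate hI (key m) m fun v => ?_))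
    (eqvGen_of_displacement d key m (max m M) (le_max_left _ _))
  rw [min_eq_right (hm ⟨v, rfl⟩)]

theorem SameOrder.symm {I J : V → MixedInterval} (hI : B.IsRep I)
    (h : B.SameOrder I J) : B.SameOrder J I := by
  intro a b hs hab hlt
  have h1 : ¬ (I a).Meets (I b) := fun h1 => hab ((hI a b).2 ⟨hs, h1⟩)
  rcases MixedInterval.prec_or_prec h1 with h3 | h3
  · exact h3.1
  · exact absurd (h b a hs.symm (fun h => hab h.symm) h3.1) hlt.asymm

/-- Representations of a finite bigraph with the same order are connected by trivial
modifications. -/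
theorem eqvGen_of_sameOrder [Finite V] {I J : V → MixedInterval} (hI : B.IsRep I)
    (hJ : B.IsRep J) (h : B.SameOrder I J) : Relation.EqvGen B.TrivialMod I J := by
  obtain ⟨h1, h2⟩ := eqvGen_halfway hI hJ h
  obtain ⟨h3, h4⟩ := eqvGen_halfway hJ hI (h.symm hI)
  refine .trans _ _ _ h1 (.trans _ _ _ (.rel _ _ (.retype h2 h4 fun v => ?_)) h3.symm)
  simp only [halfway, MixedInterval.shift]
  ring

end Bigraph

/-! ### Intervals in contact. -/

namespace MixedInterval

theorem Prec.le {I K : MixedInterval} (h : I.Prec K) : I.left + 1 ≤ K.left :=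
  ((prec_iff I K).1 h).1

theorem Prec.not_touch {I K : MixedInterval} (h : I.Prec K) (e : K.left = I.left + 1)
    (h1 : I.rightClosed = true) (h2 : K.leftClosed = true) : False :=
  ((prec_iff I K).1 h).2 e h1 h2

theorem Meets.touch {I K : MixedInterval} (h : I.Meets K) (e : K.left = I.left + 1) :
    I.rightClosed = true ∧ K.leftClosed = true := by
  rcases (meets_iff I K).1 h with h | h | h
  · linarith [h.1]
  · exact h.2
  · linarith [h.1]

theorem Meets.symm {I K : MixedInterval} (h : I.Meets K) : K.Meets I := meets_comm.1 h

theorem meets_of_lt {I K : MixedInterval} (h1 : K.left < I.left + 1)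
    (h2 : I.left < K.left + 1) : I.Meets K :=
  (meets_iff I K).2 (Or.inl ⟨h1, h2⟩)

theorem Meets.lt_of_open {I K : MixedInterval} (h : I.Meets K) (hl : ¬ I.leftClosed = true)
    (hr : ¬ I.rightClosed = true) : K.left < I.left + 1 ∧ I.left < K.left + 1 := by
  rcases (meets_iff I K).1 h with h | h | h
  · exact h
  · exact absurd h.2.1 hr
  · exact absurd h.2.2 hl

/-- If `t` and `p` have the same left end and both contain it, then an interval meeting `t` and
missing `p` starts where `t` ends. -/
theorem Meets.next {t p w : MixedInterval} (h : t.left = p.left)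
    (hp : p.leftClosed = true) (hw : t.Meets w) (hpw : ¬ p.Meets w) :
    p.Prec w ∧ w.left = t.left + 1 ∧ t.rightClosed = true ∧ w.leftClosed = true := by
  have h1 := hw.le_left_add_one
  have h2 := hw.symm.le_left_add_one
  rcases prec_or_prec hpw with h3 | h3
  · have h4 := h3.le
    have h5 : w.left = t.left + 1 := by linarith
    exact ⟨h3, h5, hw.touch h5⟩
  · have h4 := h3.le
    have h5 : t.left = w.left + 1 := by linarith
    exact (h3.not_touch (by linarith) (hw.symm.touch h5).1 hp).elim

end MixedInterval

/-! ### Uniform names for the vertices, and the left-right symmetry. -/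

/-- Names for the vertices of `T_{i,j}`, in which the two arms form one path with integer indices,
the vertex `x` having the index `0`. A vertex `pend k` hangs at `path k`, and `x0`, `y0` form the
third arm at `x`; `eL` and `eR` stand for `w₀'` and `v₀'`. -/
inductive TNode
  | path (k : ℤ) | pend (k : ℤ) | x0 | y0 | eL | eR

namespace TNode

/-- The mirror image, exchanging the two arms. -/
def flip : TNode → TNode
  | path k => path (-k)
  | pend k => pend (-k)
  | x0 => x0
  | y0 => y0
  | eL => eR
  | eR => eL

/-- The partite set of `x`. -/
def InX (i j : ℤ) : TNode → Prop
  | path k => k % 2 = 0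
  | pend k => k % 2 = 1
  | x0 => True
  | y0 => False
  | eL => i % 2 = 1
  | eR => j % 2 = 1

/-- The adjacency relation of `T_{i,j}`. -/
def Adj (i j : ℤ) : TNode → TNode → Prop
  | path k, path l => l = k + 1 ∨ k = l + 1
  | path k, pend l => k = l
  | pend k, path l => k = l
  | path k, y0 => k = 0
  | y0, path k => k = 0
  | y0, x0 => True
  | x0, y0 => True
  | path k, eL => k = -i
  | eL, path k => k = -i
  | pend k, eL => k = -i - 1
  | eL, pend k => k = -i - 1
  | path k, eR => k = j
  | eR, path k => k = j
  | pend k, eR => k = j + 1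
  | eR, pend k => k = j + 1
  | _, _ => False

/-- The vertices present, the pendant vertices at the branching vertices of the two ends of the
path being optional. -/
def Mem (i j : ℤ) (pL pR : Prop) : TNode → Prop
  | path k => -i - 2 ≤ k ∧ k ≤ j + 2
  | pend k => -i - 1 ≤ k ∧ k ≤ j + 1 ∧ (k = -i → pL) ∧ (k = j → pR)
  | _ => True

/-- The order from left to right in which vertices of different partite sets that are not
adjacent have to occur. -/
def key (i j : ℤ) : TNode → ℤ
  | path k => 2 * k
  | pend k => 2 * k
  | x0 => 1
  | y0 => 0
  | eL => -2 * i - 2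
  | eR => 2 * j + 2

/-- A representation by mixed unit intervals. -/
structure Rep (i j : ℤ) (pL pR : Prop) (J : TNode → MixedInterval) : Prop where
  one_le_left : 1 ≤ i
  one_le_right : 1 ≤ j
  meets : ∀ n m, Mem i j pL pR n → Mem i j pL pR m → Adj i j n m → (J n).Meets (J m)
  misses : ∀ n m, Mem i j pL pR n → Mem i j pL pR m → (InX i j n ↔ ¬ InX i j m) →
    ¬ Adj i j n m → ¬ (J n).Meets (J m)

/-- A representation in which the first two vertices of the arms lie on their sides of `x`. -/
structure Normal (i j : ℤ) (pL pR : Prop) (J : TNode → MixedInterval) : Prop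
    extends Rep i j pL pR J where
  right_one : (J (path 1)).left = (J (path 0)).left + 1
  left_one : (J (path (-1))).left = (J (path 0)).left - 1
  x0_left : (J x0).left = (J (path 0)).left

variable {i j : ℤ} {pL pR : Prop} {J : TNode → MixedInterval}

open MixedInterval

theorem Rep.reflect (h : Rep i j pL pR J) : Rep i j pL pR fun n => (J n).reflect 0 where
  one_le_left := h.one_le_left
  one_le_right := h.one_le_right
  meets n m hn hm ha := (meets_reflect 0 _ _).2 (h.meets n m hn hm ha)
  misses n m hn hm hc ha := fun h' => h.misses n m hn hm hc ha ((meets_reflect 0 _ _).1 h')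

theorem Mem.flip {n : TNode} (hn : Mem i j pL pR n) : Mem j i pR pL n.flip := by
  cases n <;> simp only [TNode.flip, Mem] at hn ⊢
  · omega
  · refine ⟨by omega, by omega, fun h => hn.2.2.2 (by omega), fun h => hn.2.2.1 (by omega)⟩

theorem Rep.flip (h : Rep i j pL pR J) : Rep j i pR pL fun n => (J n.flip).reflect 0 where
  one_le_left := h.one_le_right
  one_le_right := h.one_le_left
  meets n m hn hm ha := by
    refine (meets_reflect 0 _ _).2 (h.meets _ _ hn.flip hm.flip ?_)
    cases n <;> cases m <;> simp only [TNode.flip, Adj] at ha ⊢ <;> omega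
  misses n m hn hm hc ha h' := by
    refine h.misses _ _ hn.flip hm.flip ?_ ?_ ((meets_reflect 0 _ _).1 h')
    · cases n <;> cases m <;> simp only [TNode.flip, InX, true_iff, false_iff, iff_true,
        iff_false, not_not, not_true_eq_false, not_false_eq_true] at hc ⊢ <;> omega
    · cases n <;> cases m <;> simp only [TNode.flip, Adj] at ha ⊢ <;> omega

/-- Exchanging the arms and reflecting the line at once keeps each arm on its side. Every result
about the right arm thus yields its mirror image on the left. -/
theorem Normal.flip (h : Normal i j pL pR J) :
    Normal j i pR pL fun n => (J n.flip).reflect 0 where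
  toRep := h.toRep.flip
  right_one := by
    have := h.left_one
    simp only [TNode.flip, MixedInterval.reflect, neg_zero]
    linarith
  left_one := by
    have := h.right_one
    simp only [TNode.flip, MixedInterval.reflect, neg_neg, neg_zero]
    linarith
  x0_left := by
    have := h.x0_left
    simp only [TNode.flip, MixedInterval.reflect, neg_zero]
    linarith

namespace Rep

theorem meets_path (h : Rep i j pL pR J) (k l : ℤ) (h1 : -i - 2 ≤ k) (h2 : l ≤ j + 2)
    (h3 : l = k + 1) : (J (path k)).Meets (J (path l)) :=
  h.meets _ _ ⟨h1, by omega⟩ ⟨by omega, h2⟩ (Or.inl h3)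

theorem meets_pend (h : Rep i j pL pR J) (k : ℤ) (hk : Mem i j pL pR (pend k)) :
    (J (path k)).Meets (J (pend k)) :=
  h.meets _ _ ⟨by linarith [hk.1], by linarith [hk.2.1]⟩ hk rfl

theorem misses_path (h : Rep i j pL pR J) (k l : ℤ) (h1 : -i - 2 ≤ k) (h2 : l ≤ j + 2)
    (h3 : k + 3 ≤ l) (h4 : (l - k) % 2 = 1) : ¬ (J (path k)).Meets (J (path l)) := by
  refine h.misses _ _ ⟨h1, by omega⟩ ⟨by omega, h2⟩ ?_ ?_
  · simp only [InX]; omega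
  · simp only [Adj]; omega

theorem misses_pend_path (h : Rep i j pL pR J) (k l : ℤ) (hk : Mem i j pL pR (pend k))
    (h1 : -i - 2 ≤ l) (h2 : l ≤ j + 2) (h3 : k ≠ l) (h4 : (l - k) % 2 = 0) :
    ¬ (J (pend k)).Meets (J (path l)) := by
  refine h.misses _ _ hk ⟨h1, h2⟩ ?_ h3
  simp only [InX]; omega

theorem misses_pend (h : Rep i j pL pR J) (k l : ℤ) (hk : Mem i j pL pR (pend k))
    (hl : Mem i j pL pR (pend l)) (h4 : (l - k) % 2 = 1) :
    ¬ (J (pend k)).Meets (J (pend l)) := by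
  refine h.misses _ _ hk hl ?_ id
  simp only [InX]; omega

theorem mem_pend_last (h : Rep i j pL pR J) : Mem i j pL pR (pend (j + 1)) := by
  have h1 := h.one_le_left
  have h2 := h.one_le_right
  refine ⟨by omega, by omega, fun h => ?_, fun h => ?_⟩ <;> omega

theorem mem_pend_zero (h : Rep i j pL pR J) : Mem i j pL pR (pend 0) := by
  have h1 := h.one_le_left
  have h2 := h.one_le_right
  refine ⟨by omega, by omega, fun h => ?_, fun h => ?_⟩ <;> omega

theorem meets_path_eR (h : Rep i j pL pR J) : (J (path j)).Meets (J eR) :=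
  h.meets _ _ ⟨by linarith [h.one_le_left, h.one_le_right], by linarith⟩ trivial rfl

theorem meets_eR_pend (h : Rep i j pL pR J) : (J eR).Meets (J (pend (j + 1))) :=
  h.meets _ _ trivial h.mem_pend_last rfl

theorem meets_path_pend_last (h : Rep i j pL pR J) :
    (J (path (j + 1))).Meets (J (pend (j + 1))) :=
  h.meets_pend _ h.mem_pend_last

theorem misses_eR_path (h : Rep i j pL pR J) (k : ℤ) (h1 : -i - 2 ≤ k) (h2 : k ≤ j + 2)
    (h3 : k ≠ j) (h4 : (j - k) % 2 = 0) : ¬ (J eR).Meets (J (path k)) := by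
  refine h.misses _ _ trivial ⟨h1, h2⟩ ?_ h3
  simp only [InX]; omega

theorem misses_eR_pend (h : Rep i j pL pR J) (k : ℤ) (hk : Mem i j pL pR (pend k))
    (h3 : k ≠ j + 1) (h4 : (j - k) % 2 = 1) : ¬ (J eR).Meets (J (pend k)) := by
  refine h.misses _ _ trivial hk ?_ h3
  simp only [InX]; omega

theorem meets_x_y0 (h : Rep i j pL pR J) : (J (path 0)).Meets (J y0) :=
  h.meets _ _ ⟨by linarith [h.one_le_left], by linarith [h.one_le_right]⟩ trivial rfl

theorem meets_y0_x0 (h : Rep i j pL pR J) : (J y0).Meets (J x0) :=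
  h.meets _ _ trivial trivial trivial

theorem misses_y0_path (h : Rep i j pL pR J) (k : ℤ) (h1 : -i - 2 ≤ k) (h2 : k ≤ j + 2)
    (h3 : k ≠ 0) (h4 : k % 2 = 0) : ¬ (J y0).Meets (J (path k)) := by
  refine h.misses _ _ trivial ⟨h1, h2⟩ ?_ h3
  simp only [InX, false_iff, not_not]; omega

theorem misses_x0_path (h : Rep i j pL pR J) (k : ℤ) (h1 : -i - 2 ≤ k) (h2 : k ≤ j + 2)
    (h4 : k % 2 = 1) : ¬ (J x0).Meets (J (path k)) := by
  refine h.misses _ _ trivial ⟨h1, h2⟩ ?_ id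
  simp only [InX, true_iff]; omega

theorem misses_y0_pend (h : Rep i j pL pR J) (k : ℤ) (hk : Mem i j pL pR (pend k))
    (h4 : k % 2 = 1) : ¬ (J y0).Meets (J (pend k)) := by
  refine h.misses _ _ trivial hk ?_ id
  simp only [InX, false_iff, not_not]; omega

theorem misses_x0_pend (h : Rep i j pL pR J) (k : ℤ) (hk : Mem i j pL pR (pend k))
    (h4 : k % 2 = 0) : ¬ (J x0).Meets (J (pend k)) := by
  refine h.misses _ _ trivial hk ?_ id
  simp only [InX, true_iff]; omega

end Rep

/-! ### Order forced along the two arms. -/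

namespace Normal

/-- The edges from `path k` to `path (k + 1)` and from `path (k + 3)` to `path (k + 4)` form an
induced matching, so the order passes between `k` and `k + 1`. It spreads both ways from `k = -1`,
where normality decides it. -/
theorem path_path_three (h : Normal i j pL pR J) (k : ℤ) (h1 : -i - 2 ≤ k)
    (h2 : k + 3 ≤ j + 2) : (J (path k)).Prec (J (path (k + 3))) := by
  have hi := h.one_le_left
  have hj := h.one_le_right
  have base : (J (path (-1))).Prec (J (path 2)) := by
    refine ⟨?_, h.misses_path _ _ (by omega) (by omega) (by omega) (by omega)⟩
    have := (h.meets_path 1 2 (by omega) (by omega) (by omega)).symm.le_left_add_one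
    linarith [h.right_one, h.left_one]
  have up (n : ℕ) : (-1 : ℤ) + n + 3 ≤ j + 2 →
      (J (path (-1 + n))).Prec (J (path (-1 + n + 3))) := by
    induction n with
    | zero => exact fun _ => by simpa using base
    | succ n ih =>
      intro hn
      push_cast at hn ⊢
      exact (ih (by omega)).of_matching
        (h.meets_path _ _ (by omega) (by omega) (by omega))
        (h.meets_path _ _ (by omega) (by omega) (by omega))
        (h.misses_path _ _ (by omega) (by omega) (by omega) (by omega))
  have down (n : ℕ) : -i - 2 ≤ (-1 : ℤ) - n →
      (J (path (-1 - n))).Prec (J (path (-1 - n + 3))) := by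
    induction n with
    | zero => exact fun _ => by simpa using base
    | succ n ih =>
      intro hn
      push_cast at hn ⊢
      exact (ih (by omega)).of_matching
        (h.meets_path _ _ (by omega) (by omega) (by omega)).symm
        (h.meets_path _ _ (by omega) (by omega) (by omega)).symm
        (h.misses_path _ _ (by omega) (by omega) (by omega) (by omega))
  rcases le_total (-1) k with hk | hk
  · have := up (k + 1).toNat
    rw [Int.toNat_of_nonneg (by omega), show -1 + (k + 1) = k by ring] at this
    exact this h2
  · have := down (-1 - k).toNat
    rw [Int.toNat_of_nonneg (by omega), show -1 - (-1 - k) = k by ring] at this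
    exact this h1

theorem path_path (h : Normal i j pL pR J) (k l : ℤ) (h1 : -i - 2 ≤ k)
    (h2 : l ≤ j + 2) (h3 : k + 3 ≤ l) (h4 : (l - k) % 2 = 1) :
    (J (path k)).Prec (J (path l)) := by
  have key (n : ℕ) : ∀ k : ℤ, -i - 2 ≤ k → k + 3 + 2 * n ≤ j + 2 →
      (J (path k)).Prec (J (path (k + 3 + 2 * n))) := by
    induction n with
    | zero => exact fun k h1 h2 => by simpa using h.path_path_three k h1 (by simpa using h2)
    | succ n ih =>
      intro k h1 h2
      push_cast at h2 ⊢
      exact (ih (k + 1) (by omega) (by omega)).of_matching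
        (h.meets_path _ _ (by omega) (by omega) (by omega)).symm
        (h.meets_path _ _ (by omega) (by omega) (by omega))
        (h.misses_path _ _ (by omega) (by omega) (by omega) (by omega))
  have := key ((l - k - 3) / 2).toNat k h1
  rw [Int.toNat_of_nonneg (by omega), show k + 3 + 2 * ((l - k - 3) / 2) = l by omega] at this
  exact this h2

/-- The pendant edge is matched with an edge at `path l` leading outwards, or inwards when `l = j +
2`. The inward edge is too close exactly when `k = j`, a case that needs a separate argument. -/
theorem pend_path_of_ne (h : Normal i j pL pR J) (k l : ℤ) (hk : Mem i j pL pR (pend k))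
    (h2 : l ≤ j + 2) (h3 : k + 2 ≤ l) (h4 : (l - k) % 2 = 0) (h5 : k ≠ j) :
    (J (pend k)).Prec (J (path l)) := by
  have hk1 := hk.1
  have hk2 := hk.2.1
  rcases lt_or_ge l (j + 2) with hl | hl
  · exact (h.path_path k (l + 1) (by omega) (by omega) (by omega) (by omega)).of_matching
      (h.meets_pend k hk) (h.meets_path l (l + 1) (by omega) (by omega) rfl).symm
      (h.misses_pend_path k l hk (by omega) (by omega) (by omega) (by omega))
  · exact (h.path_path k (l - 1) (by omega) (by omega) (by omega) (by omega)).of_matching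
      (h.meets_pend k hk) (h.meets_path (l - 1) l (by omega) (by omega) (by omega))
      (h.misses_pend_path k l hk (by omega) (by omega) (by omega) (by omega))

theorem path_pend_of_ne (h : Normal i j pL pR J) (k l : ℤ) (hl : Mem i j pL pR (pend l))
    (h2 : -i - 2 ≤ k) (h3 : k + 2 ≤ l) (h4 : (l - k) % 2 = 0) (h5 : l ≠ -i) :
    (J (path k)).Prec (J (pend l)) := by
  have := h.flip.pend_path_of_ne (-l) (-k) hl.flip (by omega) (by omega) (by omega) (by omega)
  rw [prec_reflect] at this
  simpa [TNode.flip] using this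

/-- The pendant vertex at the end of an arm precedes the last vertex of the path. -/
theorem pend_path_last (h : Normal i j pL pR J) (hp : pR) :
    (J (pend j)).Prec (J (path (j + 2))) := by
  have hi := h.one_le_left
  have hj := h.one_le_right
  have hm : Mem i j pL pR (pend j) := ⟨by omega, by omega, fun _ => by omega, fun _ => hp⟩
  have a1 := h.path_path (j - 1) (j + 2) (by omega) (by omega) (by omega) (by omega)
  have a2 := h.path_pend_of_ne (j - 1) (j + 1) h.mem_pend_last (by omega) (by omega) (by omega)
    (by omega)
  have a3 := h.meets_path (j - 1) j (by omega) (by omega) (by omega)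
  have a4 := h.meets_pend j hm
  have a5 := h.meets_path (j + 1) (j + 2) (by omega) (by omega) (by omega)
  have a6 := h.misses_pend j (j + 1) hm h.mem_pend_last (by omega)
  have a7 := h.misses_eR_path (j + 2) (by omega) (by omega) (by omega) (by omega)
  refine (prec_or_prec (h.misses_pend_path j (j + 2) hm (by omega) (by omega) (by omega)
    (by omega))).resolve_right fun a8 => ?_
  -- The wrong order makes a chain of inequalities tight: `path (j + 2)` becomes an open interval
  -- with the left end of `path j`, and `pend j` starts one unit later.
  have b1 := a1.le
  have b2 := a2.le
  have b3 := a3.le_left_add_one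
  have b4 := a4.le_left_add_one
  have b8 := a8.le
  have c3 := a3.touch (by linarith)
  have c4 := a4.touch (by linarith)
  have d1 : ¬ (J (path (j + 2))).leftClosed = true := a1.not_touch (by linarith) c3.1
  have d2 : ¬ (J (path (j + 2))).rightClosed = true :=
    fun hr => a8.not_touch (by linarith) hr c4.2
  have b5 := a5.symm.lt_of_open d1 d2
  have b6 := h.meets_path_pend_last.le_left_add_one
  -- `pend (j + 1)` cannot lie beyond `pend j`, being too close to `path (j + 1)`. Otherwise it is
  -- squeezed into the same open interval as `path (j + 2)`, so its neighbour `eR` meets `path (j +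
  -- 2)`.
  rcases prec_or_prec a6 with a9 | a9
  · linarith [a9.le]
  · have b9 := a9.le
    have e1 : ¬ (J (pend (j + 1))).leftClosed = true := a2.not_touch (by linarith) c3.1
    have e2 : ¬ (J (pend (j + 1))).rightClosed = true :=
      fun hr => a9.not_touch (by linarith) hr c4.2
    have e3 := h.meets_eR_pend.symm.lt_of_open e1 e2
    exact a7 (meets_of_lt (by linarith) (by linarith))

theorem pend_path (h : Normal i j pL pR J) (k l : ℤ) (hk : Mem i j pL pR (pend k))
    (h2 : l ≤ j + 2) (h3 : k + 2 ≤ l) (h4 : (l - k) % 2 = 0) :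
    (J (pend k)).Prec (J (path l)) := by
  by_cases h5 : k = j
  · subst h5
    obtain rfl : l = k + 2 := by omega
    exact h.pend_path_last (hk.2.2.2 rfl)
  · exact h.pend_path_of_ne k l hk h2 h3 h4 h5

theorem path_pend (h : Normal i j pL pR J) (k l : ℤ) (hl : Mem i j pL pR (pend l))
    (h2 : -i - 2 ≤ k) (h3 : k + 2 ≤ l) (h4 : (l - k) % 2 = 0) :
    (J (path k)).Prec (J (pend l)) := by
  have := h.flip.pend_path (-l) (-k) hl.flip (by omega) (by omega) (by omega)
  rw [prec_reflect] at this
  simpa [TNode.flip] using this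

theorem pend_pend (h : Normal i j pL pR J) (k l : ℤ) (hk : Mem i j pL pR (pend k))
    (hl : Mem i j pL pR (pend l)) (h3 : k < l) (h4 : (l - k) % 2 = 1) :
    (J (pend k)).Prec (J (pend l)) := by
  have hk1 := hk.1
  have hl2 := hl.2.1
  have hm := h.misses_pend k l hk hl h4
  rcases (show l = k + 1 ∨ k + 3 ≤ l by omega) with rfl | h5
  -- In the wrong order both pendants are squeezed between `path (k - 1)` and `path (k + 2)`, at
  -- most 3 apart. All gaps equal 1, and the contacts with the path make the two pendants touch at
  -- closed ends.
  · refine (prec_or_prec hm).resolve_right fun a => ?_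
    have a1 := h.path_pend (k - 1) (k + 1) hl (by omega) (by omega) (by omega)
    have a2 := h.pend_path k (k + 2) hk (by omega) (by omega) (by omega)
    have b1 := (h.meets_path (k - 1) k (by omega) (by omega) (by omega)).le_left_add_one
    have b2 := (h.meets_path k (k + 1) (by omega) (by omega) (by omega)).le_left_add_one
    have b3 := (h.meets_path (k + 1) (k + 2) (by omega) (by omega) (by omega)).le_left_add_one
    have c1 := a1.le
    have c2 := a2.le
    have c3 := a.le
    exact a.not_touch (by linarith)
      ((h.meets_pend (k + 1) hl).symm.touch (by linarith)).1
      ((h.meets_pend k hk).touch (by linarith)).2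
  · exact (h.path_path k l (by omega) (by omega) h5 h4).of_matching (h.meets_pend k hk)
      (h.meets_pend l hl) hm

theorem path_eR (h : Normal i j pL pR J) (k : ℤ) (h1 : -i - 2 ≤ k) (h2 : k < j)
    (h4 : (j - k) % 2 = 0) : (J (path k)).Prec (J eR) := by
  have hi := h.one_le_left
  have hj := h.one_le_right
  have hm : ¬ (J (path k)).Meets (J eR) :=
    fun hm => h.misses_eR_path k h1 (by omega) (by omega) h4 hm.symm
  rcases h1.eq_or_lt with rfl | h1
  · exact (h.path_path (-i - 2 + 1) j (by omega) (by omega) (by omega) (by omega)).of_matching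
      (h.meets_path _ _ (by omega) (by omega) rfl).symm h.meets_path_eR hm
  · exact (h.path_path (k - 1) j (by omega) (by omega) (by omega) (by omega)).of_matching
      (h.meets_path _ _ (by omega) (by omega) (by omega)) h.meets_path_eR hm

theorem pend_eR (h : Normal i j pL pR J) (k : ℤ) (hk : Mem i j pL pR (pend k)) (h2 : k < j)
    (h4 : (j - k) % 2 = 1) : (J (pend k)).Prec (J eR) := by
  have hm : ¬ (J (pend k)).Meets (J eR) :=
    fun hm => h.misses_eR_pend k hk (by omega) h4 hm.symm
  have hk1 := hk.1
  exact (h.path_pend k (j + 1) h.mem_pend_last (by omega) (by omega) (by omega)).of_matching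
    (h.meets_pend k hk) h.meets_eR_pend.symm hm

theorem x0_path_one (h : Normal i j pL pR J) : (J x0).Prec (J (path 1)) :=
  ⟨by linarith [h.x0_left, h.right_one],
    h.misses_x0_path 1 (by linarith [h.one_le_left]) (by linarith [h.one_le_right]) rfl⟩

/-- The edge between `y0` and `x0` forms an induced matching with each edge of the right arm beyond
`x`; the two parities feed each other in the induction. -/
theorem core_path (h : Normal i j pL pR J) (k : ℤ) (h1 : 1 ≤ k) (h2 : k ≤ j + 2) :
    (k % 2 = 1 → (J x0).Prec (J (path k))) ∧ (k % 2 = 0 → (J y0).Prec (J (path k))) := by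
  have hi := h.one_le_left
  induction k, h1 using Int.leInduction with
  | base => exact ⟨fun _ => h.x0_path_one, fun hk => by omega⟩
  | succ k hk ih =>
    obtain ⟨ih1, ih2⟩ := ih (by omega)
    have hm := h.meets_path k (k + 1) (by omega) (by omega) rfl
    exact ⟨fun h3 => (ih2 (by omega)).of_matching h.meets_y0_x0 hm
        (h.misses_x0_path _ (by omega) (by omega) h3),
      fun h3 => (ih1 (by omega)).of_matching h.meets_y0_x0.symm hm
        (h.misses_y0_path _ (by omega) (by omega) (by omega) h3)⟩

theorem x0_path (h : Normal i j pL pR J) (k : ℤ) (h1 : 1 ≤ k) (h2 : k ≤ j + 2)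
    (h3 : k % 2 = 1) : (J x0).Prec (J (path k)) :=
  (h.core_path k h1 h2).1 h3

theorem y0_path (h : Normal i j pL pR J) (k : ℤ) (h1 : 1 ≤ k) (h2 : k ≤ j + 2)
    (h3 : k % 2 = 0) : (J y0).Prec (J (path k)) :=
  (h.core_path k h1 h2).2 h3

theorem x0_pend (h : Normal i j pL pR J) (k : ℤ) (hk : Mem i j pL pR (pend k)) (h1 : 1 ≤ k)
    (h3 : k % 2 = 0) : (J x0).Prec (J (pend k)) :=
  (h.y0_path k h1 (by linarith [hk.2.1]) h3).of_matching h.meets_y0_x0 (h.meets_pend k hk)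
    (h.misses_x0_pend k hk h3)

theorem y0_pend (h : Normal i j pL pR J) (k : ℤ) (hk : Mem i j pL pR (pend k)) (h1 : 1 ≤ k)
    (h3 : k % 2 = 1) : (J y0).Prec (J (pend k)) :=
  (h.x0_path k h1 (by linarith [hk.2.1]) h3).of_matching h.meets_y0_x0.symm (h.meets_pend k hk)
    (h.misses_y0_pend k hk h3)

theorem x0_eR (h : Normal i j pL pR J) (hj : j % 2 = 0) : (J x0).Prec (J eR) := by
  refine (h.y0_path j h.one_le_right (by omega) hj).of_matching h.meets_y0_x0 h.meets_path_eR
    (h.misses _ _ trivial trivial ?_ id)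
  simp only [InX, true_iff]; omega

theorem y0_eR (h : Normal i j pL pR J) (hj : j % 2 = 1) : (J y0).Prec (J eR) := by
  refine (h.x0_path j h.one_le_right (by omega) hj).of_matching h.meets_y0_x0.symm
    h.meets_path_eR (h.misses _ _ trivial trivial ?_ id)
  simp only [InX, false_iff, not_not]; omega

theorem meets_path_eL (h : Normal i j pL pR J) : (J (path (-i))).Meets (J eL) :=
  h.meets _ _ ⟨by omega, by linarith [h.one_le_left, h.one_le_right]⟩ trivial rfl

theorem eL_eR (h : Normal i j pL pR J) (hij : (i + j) % 2 = 1) : (J eL).Prec (J eR) := by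
  have hi := h.one_le_left
  have hj := h.one_le_right
  refine (h.path_path (-i) j (by omega) (by omega) (by omega) (by omega)).of_matching
    h.meets_path_eL h.meets_path_eR (h.misses _ _ trivial trivial ?_ id)
  simp only [InX]; omega

/-- `x0` lies exactly between `path (-1)` and `path 1`, whose facing ends are closed because they
touch `path 0`. -/
theorem x0_open (h : Normal i j pL pR J) :
    ¬ (J x0).leftClosed = true ∧ ¬ (J x0).rightClosed = true := by
  have hi := h.one_le_left
  have hj := h.one_le_right
  have h1 := (h.meets_path 0 1 (by omega) (by omega) rfl).touch h.right_one
  have h2 := (h.meets_path (-1) 0 (by omega) (by omega) rfl).touch (by linarith [h.left_one])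
  have h3 : (J (path (-1))).Prec (J x0) := ⟨by linarith [h.x0_left, h.left_one],
    fun hm => h.misses_x0_path (-1) (by omega) (by omega) rfl hm.symm⟩
  exact ⟨h3.not_touch (by linarith [h.x0_left, h.left_one]) h2.1,
    fun hr => h.x0_path_one.not_touch (by linarith [h.x0_left, h.right_one]) hr h1.2⟩

/-- Equality at one index forces equality at the preceding one. At index 0, `pend 1` would share the
left end of the open interval of `x0`, and `y0`, which overlaps `x0`, would meet it. -/
theorem path_ne_pend (h : Normal i j pL pR J) (k : ℕ) (hk : Mem i j pL pR (pend (k + 1)))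
    (hk' : (k : ℤ) + 1 ≤ j) : (J (path k)).left ≠ (J (pend (k + 1))).left := by
  have hi := h.one_le_left
  induction k with
  | zero =>
    intro he
    have h1 := h.meets_y0_x0.symm.lt_of_open h.x0_open.1 h.x0_open.2
    have h2 := h.x0_left
    simp only [CharP.cast_eq_zero, zero_add] at he hk
    exact h.misses_y0_pend 1 hk rfl (meets_of_lt (by linarith) (by linarith))
  | succ k ih =>
    intro he
    push_cast at he hk hk'
    have hm : Mem i j pL pR (pend (k + 1)) :=
      ⟨by omega, by omega, fun h => by omega, fun h => by omega⟩
    have h1 := (h.path_pend k (k + 1 + 1) hk (by omega) (by omega) (by omega)).le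
    have h2 := (h.pend_pend (k + 1) (k + 1 + 1) hm hk (by omega) (by omega)).le
    have h3 := (h.meets_path k (k + 1) (by omega) (by omega) rfl).le_left_add_one
    have h4 := (h.meets_pend (k + 1) hm).symm.le_left_add_one
    exact ih hm (by omega) (by linarith)

theorem eR_path_last (h : Normal i j pL pR J) (hp : pR) : (J eR).Prec (J (path (j + 2))) := by
  have hi := h.one_le_left
  have hj := h.one_le_right
  have hm : Mem i j pL pR (pend j) := ⟨by omega, by omega, fun _ => by omega, fun _ => hp⟩
  refine (prec_or_prec (h.misses_eR_path (j + 2) (by omega) (by omega) (by omega)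
    (by omega))).resolve_right fun a => ?_
  -- The wrong order forces `path (j - 1)` and `pend j` to share their left end.
  have h1 := (h.pend_path_last hp).le
  have h2 := (h.meets_pend j hm).symm.le_left_add_one
  have h3 := h.meets_path_eR.le_left_add_one
  have h4 := (h.path_path (j - 1) (j + 2) (by omega) (by omega) (by omega) (by omega)).le
  have h5 := (h.meets_path (j - 1) j (by omega) (by omega) (by omega)).le_left_add_one
  have h6 := a.le
  have h7 := h.path_ne_pend (j - 1).toNat
  rw [Int.toNat_of_nonneg (by omega), sub_add_cancel] at h7
  exact h7 hm le_rfl (by linarith)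

/-! ### The two possible sides of the pendant vertex at `x`. -/

/-- If the pendant vertex at `x` lies to the right of `x`, then the position of the right arm is
forced. -/
theorem path_eq_pend (h : Normal i j pL pR J)
    (hy : (J (pend 0)).left = (J (path 0)).left + 1) (k : ℕ) (hk : (k : ℤ) + 1 ≤ j) :
    (J (path (k + 1))).left = (J (pend k)).left ∧ (J (path (k + 1))).leftClosed = true ∧
      (J (pend k)).leftClosed = true := by
  have hi := h.one_le_left
  induction k with
  | zero =>
    simp only [CharP.cast_eq_zero, zero_add]
    exact ⟨by linarith [h.right_one],
      ((h.meets_path 0 1 (by omega) (by omega) rfl).touch h.right_one).2,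
      ((h.meets_pend 0 h.mem_pend_zero).touch hy).2⟩
  | succ k ih =>
    push_cast at hk ⊢
    obtain ⟨h1, h2, h3⟩ := ih (by omega)
    have hm : Mem i j pL pR (pend (k + 1)) :=
      ⟨by omega, by omega, fun h => by omega, fun h => by omega⟩
    have hm' : Mem i j pL pR (pend k) :=
      ⟨by omega, by omega, fun h => by omega, fun h => by omega⟩
    -- `path (k + 2)` and `pend (k + 1)` both meet `path (k + 1)` and miss `pend k`, which starts at
    -- the same closed end; so both start where `path (k + 1)` ends.
    have a := Meets.next h1 h3 (h.meets_path (k + 1) (k + 1 + 1) (by omega) (by omega) rfl)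
      (h.misses_pend_path k (k + 1 + 1) hm' (by omega) (by omega) (by omega) (by omega))
    have b := Meets.next h1 h3 (h.meets_pend (k + 1) hm)
      (h.misses_pend k (k + 1) hm' hm (by omega))
    exact ⟨by linarith [a.2.1, b.2.1], a.2.2.2, b.2.2.2⟩

/-- The forced coincidences reach the branching end: `path (j + 1)`, `eR` and a possible `pend j`
all start where `path j` ends. With `pend j` present, `pend (j + 1)` forces the right end of `eR` to
be closed, so `eR` would touch `path (j + 2)`. -/
theorem right_end (h : Normal i j pL pR J)
    (hy : (J (pend 0)).left = (J (path 0)).left + 1) :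
    (J eR).Prec (J (path (j + 2))) ∧ ¬ pR := by
  have hi := h.one_le_left
  have hj := h.one_le_right
  have key := h.path_eq_pend hy (j - 1).toNat
  rw [Int.toNat_of_nonneg (by omega), sub_add_cancel] at key
  obtain ⟨h1, h2, h3⟩ := key le_rfl
  have hm' : Mem i j pL pR (pend (j - 1)) :=
    ⟨by omega, by omega, fun h => by omega, fun h => by omega⟩
  obtain ⟨-, a1, -, a2⟩ := Meets.next h1 h3
    (h.meets_path j (j + 1) (by omega) (by omega) rfl)
    (h.misses_pend_path (j - 1) (j + 1) hm' (by omega) (by omega) (by omega) (by omega))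
  obtain ⟨-, b1, -, b2⟩ := Meets.next h1 h3 h.meets_path_eR
    (fun hm => h.misses_eR_pend (j - 1) hm' (by omega) (by omega) hm.symm)
  obtain ⟨c1, c2, c3, c4⟩ := Meets.next (a1.trans b1.symm) b2
    (h.meets_path (j + 1) (j + 2) (by omega) (by omega) (by omega))
    (h.misses_eR_path (j + 2) (by omega) (by omega) (by omega) (by omega))
  refine ⟨c1, fun hp => ?_⟩
  have hm : Mem i j pL pR (pend j) := ⟨by omega, by omega, fun _ => by omega, fun _ => hp⟩
  obtain ⟨-, d1, -, d2⟩ := Meets.next h1 h3 (h.meets_pend j hm)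
    (h.misses_pend (j - 1) j hm' hm (by omega))
  obtain ⟨-, e1, e2, -⟩ := Meets.next (b1.trans d1.symm) d2 h.meets_eR_pend
    (h.misses_pend j (j + 1) hm h.mem_pend_last (by omega))
  exact c1.not_touch (by linarith) e2 c4

/-- `pend 0` meets `path 0` but misses `x0`, which has the same left end. -/
theorem pend_zero_left (h : Normal i j pL pR J) :
    (J (pend 0)).left = (J (path 0)).left + 1 ∨ (J (pend 0)).left = (J (path 0)).left - 1 := by
  have h1 := h.meets_pend 0 h.mem_pend_zero
  have h2 := h1.le_left_add_one
  have h3 := h1.symm.le_left_add_one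
  have h4 := h.x0_left
  rcases prec_or_prec (h.misses_x0_pend 0 h.mem_pend_zero rfl) with h5 | h5
  · exact Or.inl (by linarith [h5.le])
  · exact Or.inr (by linarith [h5.le])

theorem left_end (h : Normal i j pL pR J)
    (hy : (J (pend 0)).left = (J (path 0)).left - 1) :
    (J (path (-i - 2))).Prec (J eL) ∧ ¬ pL := by
  have := h.flip.right_end (by
    simp only [TNode.flip, MixedInterval.reflect, neg_zero]
    linarith)
  rw [prec_reflect, TNode.flip, TNode.flip, show -(i + 2) = -i - 2 by ring] at this
  exact this

theorem not_both (h : Normal i j True True J) : False := by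
  rcases h.pend_zero_left with hy | hy
  · exact (h.right_end hy).2 trivial
  · exact (h.left_end hy).2 trivial

end Normal

end TNode

/-! ### The middle arm at `x`. -/

namespace MixedInterval

/-- The two edges of an induced matching lie apart from each other. -/
theorem matching_order {a b c d : MixedInterval} (hab : a.Meets b) (hcd : c.Meets d)
    (had : ¬ a.Meets d) (hbc : ¬ b.Meets c) :
    (a.Prec d ∧ b.Prec c) ∨ (d.Prec a ∧ c.Prec b) := by
  rcases prec_or_prec had with h | h
  · exact Or.inl ⟨h, h.of_matching hab hcd.symm hbc⟩
  · exact Or.inr ⟨h, h.of_matching hcd.symm hab fun h' => hbc h'.symm⟩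

/-- If `x` meets both `a` and `b`, and `w` lies between `a` and `b`, then `w` is the interior
of `x`. -/
theorem eq_interior {x a b w : MixedInterval} (ha : x.Meets a) (hb : x.Meets b)
    (haw : a.Prec w) (hwb : w.Prec b) :
    (a.left = x.left - 1 ∧ b.left = x.left + 1 ∧ w.left = x.left) ∧
      ∀ v : MixedInterval, w.Meets v → x.Meets v := by
  have h1 := ha.symm.le_left_add_one
  have h2 := hb.le_left_add_one
  have h3 := haw.le
  have h4 := hwb.le
  have h5 := ha.symm.touch (by linarith)
  have h6 := hb.touch (by linarith)
  refine ⟨⟨by linarith, by linarith, by linarith⟩, fun v hv => ?_⟩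
  have h7 := hv.lt_of_open (haw.not_touch (by linarith) h5.1)
    (fun hr => hwb.not_touch (by linarith) hr h6.2)
  exact meets_of_lt (by linarith) (by linarith)

end MixedInterval

namespace TNode

open MixedInterval

variable {i j : ℤ} {pL pR : Prop} {J : TNode → MixedInterval}

theorem Rep.normal_of_between (h : Rep i j pL pR J) (h1 : (J (path (-1))).Prec (J x0))
    (h2 : (J x0).Prec (J (path 1))) : Normal i j pL pR J := by
  have hi := h.one_le_left
  have hj := h.one_le_right
  obtain ⟨⟨a, b, c⟩, -⟩ := eq_interior
    (h.meets_path (-1) 0 (by omega) (by omega) rfl).symm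
    (h.meets_path 0 1 (by omega) (by omega) rfl) h1 h2
  exact ⟨h, b, a, c⟩

theorem Rep.normal_or (h : Rep i j pL pR J) :
    Normal i j pL pR J ∨ Normal i j pL pR fun n => (J n).reflect 0 := by
  have hi := h.one_le_left
  have hj := h.one_le_right
  have mL := h.meets_path (-2) (-1) (by omega) (by omega) rfl
  have mR := h.meets_path 1 2 (by omega) (by omega) rfl
  have mY := h.meets_y0_x0
  have xL := (h.meets_path (-1) 0 (by omega) (by omega) rfl).symm
  have xR := h.meets_path 0 1 (by omega) (by omega) rfl
  have xY := h.meets_x_y0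
  have hLY := matching_order mL.symm mY
    (fun hm => h.misses_x0_path (-1) (by omega) (by omega) rfl hm.symm)
    (fun hm => h.misses_y0_path (-2) (by omega) (by omega) (by omega) rfl hm.symm)
  have hRY := matching_order mR mY
    (fun hm => h.misses_x0_path 1 (by omega) (by omega) rfl hm.symm)
    (fun hm => h.misses_y0_path 2 (by omega) (by omega) (by omega) rfl hm.symm)
  have hLR := matching_order mL.symm mR
    (h.misses_path (-1) 2 (by omega) (by omega) (by omega) rfl)
    (h.misses_path (-2) 1 (by omega) (by omega) (by omega) rfl)
  -- Were a long arm in the middle, its second vertex would fill the interior of `path 0`, and the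
  -- third vertex would meet `path 0`. The arm of `y0` and `x0` has no third vertex.
  have nL : ¬ ∀ v : MixedInterval, (J (path (-2))).Meets v → (J (path 0)).Meets v := fun hv =>
    h.misses_path (-3) 0 (by omega) (by omega) (by omega) rfl
      (hv _ (h.meets_path (-3) (-2) (by omega) (by omega) rfl).symm).symm
  have nR : ¬ ∀ v : MixedInterval, (J (path 2)).Meets v → (J (path 0)).Meets v := fun hv =>
    h.misses_path 0 3 (by omega) (by omega) (by omega) rfl
      (hv _ (h.meets_path 2 3 (by omega) (by omega) rfl))
  rcases hLY with ⟨a1, a2⟩ | ⟨a1, a2⟩ <;> rcases hRY with ⟨b1, b2⟩ | ⟨b1, b2⟩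
  · rcases hLR with ⟨c1, c2⟩ | ⟨c1, c2⟩
    · exact (nR (eq_interior xL xY c1 b2).2).elim
    · exact (nL (eq_interior xR xY c2 a2).2).elim
  · exact Or.inl (h.normal_of_between a1 b1)
  · exact Or.inr (h.reflect.normal_of_between ((prec_reflect 0 _ _).2 a1)
      ((prec_reflect 0 _ _).2 b1))
  · rcases hLR with ⟨c1, c2⟩ | ⟨c1, c2⟩
    · exact (nL (eq_interior xY xR a2 c2).2).elim
    · exact (nR (eq_interior xY xL b2 c1).2).elim

/-! ### The complete order, with a pendant vertex at the right end only. -/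

namespace Normal

theorem path_x0 (h : Normal i j pL pR J) (k : ℤ) (h1 : k ≤ -1) (h2 : -i - 2 ≤ k)
    (h3 : k % 2 = 1) : (J (path k)).Prec (J x0) := by
  have := h.flip.x0_path (-k) (by omega) (by omega) (by omega)
  rw [prec_reflect] at this
  simpa [TNode.flip] using this

theorem path_y0 (h : Normal i j pL pR J) (k : ℤ) (h1 : k ≤ -1) (h2 : -i - 2 ≤ k)
    (h3 : k % 2 = 0) : (J (path k)).Prec (J y0) := by
  have := h.flip.y0_path (-k) (by omega) (by omega) (by omega)
  rw [prec_reflect] at this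
  simpa [TNode.flip] using this

theorem pend_x0 (h : Normal i j pL pR J) (k : ℤ) (hk : Mem i j pL pR (pend k)) (h1 : k ≤ -1)
    (h3 : k % 2 = 0) : (J (pend k)).Prec (J x0) := by
  have := h.flip.x0_pend (-k) hk.flip (by omega) (by omega)
  rw [prec_reflect] at this
  simpa [TNode.flip] using this

theorem pend_y0 (h : Normal i j pL pR J) (k : ℤ) (hk : Mem i j pL pR (pend k)) (h1 : k ≤ -1)
    (h3 : k % 2 = 1) : (J (pend k)).Prec (J y0) := by
  have := h.flip.y0_pend (-k) hk.flip (by omega) (by omega)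
  rw [prec_reflect] at this
  simpa [TNode.flip] using this

theorem eL_x0 (h : Normal i j pL pR J) (hi : i % 2 = 0) : (J eL).Prec (J x0) :=
  (prec_reflect 0 _ _).1 (h.flip.x0_eR hi)

theorem eL_y0 (h : Normal i j pL pR J) (hi : i % 2 = 1) : (J eL).Prec (J y0) :=
  (prec_reflect 0 _ _).1 (h.flip.y0_eR hi)

theorem eL_path (h : Normal i j pL pR J) (k : ℤ) (h1 : k ≤ j + 2) (h2 : -i < k)
    (h4 : (i + k) % 2 = 0) : (J eL).Prec (J (path k)) := by
  have := h.flip.path_eR (-k) (by omega) (by omega) (by omega)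
  rw [prec_reflect] at this
  simpa [TNode.flip] using this

theorem eL_pend (h : Normal i j pL pR J) (k : ℤ) (hk : Mem i j pL pR (pend k)) (h2 : -i < k)
    (h4 : (i + k) % 2 = 1) : (J eL).Prec (J (pend k)) := by
  have := h.flip.pend_eR (-k) hk.flip (by omega) (by omega)
  rw [prec_reflect] at this
  simpa [TNode.flip] using this

/-- The three relations not forced by matchings alone are `s1`, `s2` and `s3`. They hold because
`pend j` is present, which puts `pend 0` on the left; the rest is a case distinction. -/
theorem prec_of_key_lt (h : Normal i j False True J) {n m : TNode}
    (hn : Mem i j False True n) (hm : Mem i j False True m) (hc : InX i j n ↔ ¬ InX i j m)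
    (ha : ¬ Adj i j n m) (hk : key i j n < key i j m) : (J n).Prec (J m) := by
  have hi := h.one_le_left
  have hj := h.one_le_right
  have hy : (J (pend 0)).left = (J (path 0)).left - 1 :=
    h.pend_zero_left.resolve_left fun hy => (h.right_end hy).2 trivial
  have s1 : (J (pend 0)).Prec (J x0) := ⟨by linarith [h.x0_left],
    fun hm => h.misses_x0_pend 0 h.mem_pend_zero rfl hm.symm⟩
  have s2 := (h.left_end hy).1
  have s3 := h.eR_path_last trivial
  cases n with
  | path k =>
    cases m with
    | path l =>
      simp only [Mem, InX, Adj, key] at hn hm hc ha hk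
      exact h.path_path k l (by omega) (by omega) (by omega) (by omega)
    | pend l =>
      have hm' := hm
      simp only [Mem, InX, Adj, key] at hn hm hc ha hk
      exact h.path_pend k l hm' (by omega) (by omega) (by omega)
    | x0 =>
      simp only [Mem, InX, key, not_true_eq_false, iff_false] at hn hc hk
      exact h.path_x0 k (by omega) (by omega) (by omega)
    | y0 =>
      simp only [Mem, InX, Adj, key, not_false_eq_true, iff_true] at hn hc ha hk
      exact h.path_y0 k (by omega) (by omega) (by omega)
    | eL =>
      simp only [Mem, InX, Adj, key] at hn hc ha hk
      obtain rfl : k = -i - 2 := by omega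
      exact s2
    | eR =>
      simp only [Mem, InX, Adj, key] at hn hc ha hk
      exact h.path_eR k (by omega) (by omega) (by omega)
  | pend k =>
    have hn' := hn
    cases m with
    | path l =>
      simp only [Mem, InX, Adj, key] at hn hm hc ha hk
      exact h.pend_path k l hn' (by omega) (by omega) (by omega)
    | pend l =>
      simp only [InX, key] at hc hk
      exact h.pend_pend k l hn' hm (by omega) (by omega)
    | x0 =>
      simp only [InX, key, not_true_eq_false, iff_false] at hc hk
      rcases (show k = 0 ∨ k ≤ -1 by omega) with rfl | hk0
      · exact s1
      · exact h.pend_x0 k hn' hk0 (by omega)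
    | y0 =>
      simp only [InX, key, not_false_eq_true, iff_true] at hc hk
      exact h.pend_y0 k hn' (by omega) (by omega)
    | eL =>
      simp only [Mem, key] at hn hk
      omega
    | eR =>
      simp only [InX, Adj, key] at hc ha hk
      exact h.pend_eR k hn' (by omega) (by omega)
  | x0 =>
    cases m with
    | path l =>
      simp only [Mem, InX, key, true_iff] at hm hc hk
      exact h.x0_path l (by omega) (by omega) (by omega)
    | pend l =>
      simp only [InX, key, true_iff] at hc hk
      exact h.x0_pend l hm (by omega) (by omega)
    | x0 => exact absurd hk (lt_irrefl _)
    | y0 => exact absurd trivial ha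
    | eL =>
      simp only [key] at hk
      omega
    | eR =>
      simp only [InX, true_iff] at hc
      exact h.x0_eR (by omega)
  | y0 =>
    cases m with
    | path l =>
      simp only [Mem, InX, key, false_iff, not_not] at hm hc hk
      exact h.y0_path l (by omega) (by omega) (by omega)
    | pend l =>
      simp only [InX, key, false_iff, not_not] at hc hk
      exact h.y0_pend l hm (by omega) (by omega)
    | x0 => exact absurd trivial ha
    | y0 => exact absurd hk (lt_irrefl _)
    | eL =>
      simp only [key] at hk
      omega
    | eR =>
      simp only [InX, false_iff, not_not] at hc
      exact h.y0_eR (by omega)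
  | eL =>
    cases m with
    | path l =>
      simp only [Mem, InX, Adj, key] at hm hc ha hk
      exact h.eL_path l (by omega) (by omega) (by omega)
    | pend l =>
      simp only [InX, Adj, key] at hc ha hk
      exact h.eL_pend l hm (by omega) (by omega)
    | x0 =>
      simp only [InX, not_true_eq_false, iff_false] at hc
      exact h.eL_x0 (by omega)
    | y0 =>
      simp only [InX, not_false_eq_true, iff_true] at hc
      exact h.eL_y0 (by omega)
    | eL => exact absurd hk (lt_irrefl _)
    | eR =>
      simp only [InX] at hc
      exact h.eL_eR (by omega)
  | eR =>
    cases m with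
    | path l =>
      simp only [Mem, InX, Adj, key] at hm hc ha hk
      obtain rfl : l = j + 2 := by omega
      exact s3
    | pend l =>
      simp only [Mem, key] at hm hk
      omega
    | eR => exact absurd hk (lt_irrefl _)
    | _ =>
      simp only [key] at hk
      omega

end Normal

/-- Together with `Normal.prec_of_key_lt` this decides the order of every relevant pair. -/
theorem key_ne {n m : TNode} (hc : InX i j n ↔ ¬ InX i j m) (ha : ¬ Adj i j n m) (hi : 1 ≤ i)
    (hj : 1 ≤ j) : key i j n ≠ key i j m := by
  cases n <;> cases m <;>
    simp only [InX, Adj, key, not_true_eq_false, not_false_eq_true, iff_false, iff_true,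
      true_iff, false_iff, not_not] at hc ha ⊢ <;> omega

/-! ### Passing from graph embeddings to representations. -/

/-- A proper colouring with two colours agrees with the bipartition. -/
theorem eq_iff_inX {f : TNode → Bool} (hi : 1 ≤ i) (hj : 1 ≤ j)
    (hf : ∀ n m, Mem i j pL pR n → Mem i j pL pR m → Adj i j n m → f n ≠ f m) (n : TNode)
    (hn : Mem i j pL pR n) : f n = f (path 0) ↔ InX i j n := by
  have hpath (k : ℤ) (h1 : -i - 2 ≤ k) (h2 : k ≤ j + 2) :
      f (path k) = f (path 0) ↔ k % 2 = 0 := by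
    have up (k : ℕ) : (k : ℤ) ≤ j + 2 → (f (path k) = f (path 0) ↔ (k : ℤ) % 2 = 0) := by
      induction k with
      | zero => simp
      | succ k ih =>
        intro hk
        push_cast at hk ⊢
        have h1 := ih (by omega)
        have h2 := hf (path k) (path (k + 1)) ⟨by omega, by omega⟩ ⟨by omega, by omega⟩ (Or.inl rfl)
        have h3 : ((k : ℤ) + 1) % 2 = 0 ↔ ¬ (k : ℤ) % 2 = 0 := by omega
        rw [h3, ← h1]
        revert h2
        cases f (path k) <;> cases f (path (k + 1)) <;> cases f (path 0) <;> decide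
    have down (k : ℕ) : -i - 2 ≤ -(k : ℤ) →
        (f (path (-k)) = f (path 0) ↔ (k : ℤ) % 2 = 0) := by
      induction k with
      | zero => simp
      | succ k ih =>
        intro hk
        push_cast at hk ⊢
        have h1 := ih (by omega)
        have h2 := hf (path (-k)) (path (-(k + 1))) ⟨by omega, by omega⟩ ⟨by omega, by omega⟩
          (Or.inr (by ring))
        have h3 : ((k : ℤ) + 1) % 2 = 0 ↔ ¬ (k : ℤ) % 2 = 0 := by omega
        rw [h3, ← h1]
        revert h2
        cases f (path (-k)) <;> cases f (path (-(k + 1))) <;> cases f (path 0) <;> decide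
    rcases le_total 0 k with h | h
    · lift k to ℕ using h
      exact up k h2
    · obtain ⟨k, rfl⟩ : ∃ l : ℤ, k = -l := ⟨-k, by ring⟩
      lift k to ℕ using by omega
      rw [down k h1]
      omega
  have step {n m : TNode} (hn : Mem i j pL pR n) (hm : Mem i j pL pR m) (ha : Adj i j n m) :
      f m = f (path 0) ↔ ¬ f n = f (path 0) := by
    have := hf n m hn hm ha
    revert this
    cases f n <;> cases f m <;> cases f (path 0) <;> decide
  have hy : f y0 = f (path 0) ↔ ¬ True := by
    rw [step (n := path 0) (m := y0) ⟨by omega, by omega⟩ trivial rfl]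
    simp
  cases n with
  | path k => exact hpath k hn.1 hn.2
  | pend k =>
    have := hn.1
    have := hn.2.1
    rw [step (n := path k) (m := pend k) ⟨by omega, by omega⟩ hn rfl,
      hpath k (by omega) (by omega), InX]
    omega
  | x0 =>
    rw [step (n := y0) (m := x0) trivial trivial trivial, hy]
    simp [InX]
  | y0 =>
    rw [hy]
    simp [InX]
  | eL =>
    rw [step (n := path (-i)) (m := eL) ⟨by omega, by omega⟩ trivial rfl,
      hpath _ (by omega) (by omega), InX]
    omega
  | eR =>
    rw [step (n := path j) (m := eR) ⟨by omega, by omega⟩ trivial rfl,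
      hpath _ (by omega) (by omega), InX]
    omega

end TNode

/-- A representation of a bigraph containing the vertices named by `Mem i j pL pR` as an induced
subgraph restricts to these vertices. -/
theorem Bigraph.IsRep.node_rep {V : Type u} {B : Bigraph V} {I : V → MixedInterval}
    (hI : B.IsRep I) {i j : ℤ} {pL pR : Prop} (hi : 1 ≤ i) (hj : 1 ≤ j) (ψ : TNode → V)
    (h : ∀ n m, TNode.Mem i j pL pR n → TNode.Mem i j pL pR m →
      (B.graph.Adj (ψ n) (ψ m) ↔ TNode.Adj i j n m)) :
    TNode.Rep i j pL pR fun n => I (ψ n) where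
  one_le_left := hi
  one_le_right := hj
  meets n m hn hm ha := ((hI _ _).1 ((h n m hn hm).2 ha)).2
  misses n m hn hm hc ha := by
    intro hmeet
    -- The embedding concerns graphs only and need not respect partite sets. Connectedness makes the
    -- sides in `B` agree with the bipartition up to a swap, enough to tell which pairs are
    -- separated.
    have key := TNode.eq_iff_inX (f := fun n => B.side (ψ n)) hi hj
      fun n m hn hm ha => B.side_ne _ _ ((h n m hn hm).2 ha)
    refine ha ((h n m hn hm).1 ((hI _ _).2 ⟨fun hs => ?_, hmeet⟩))
    rw [← key n hn, ← key m hm, hs] at hc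
    tauto

/-! ### The bigraph $T'_{i,j}$: the given representation and its uniqueness. -/

namespace TVertex

variable {i j : ℕ}

/-- The name of a vertex of `T'_{i,j}`. -/
def node : TVertex i j → TNode
  | x => .path 0
  | x0 => .x0
  | y => .pend 0
  | y0 => .y0
  | left k => .path (-(k + 1))
  | leftPendant k => .pend (-(k + 1))
  | w0 => .path (-i - 1)
  | w0' => .eL
  | z0 => .path (-i - 2)
  | z0' => .pend (-i - 1)
  | right k => .path (k + 1)
  | rightPendant k => .pend (k + 1)
  | v' => .pend j
  | v0 => .path (j + 1)
  | v0' => .eR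
  | u0 => .path (j + 2)
  | u0' => .pend (j + 1)

theorem node_injective (hi : 1 ≤ i) (hj : 1 ≤ j) :
    Function.Injective (node : TVertex i j → TNode) := by
  intro a b h
  cases a <;> cases b <;>
    simp only [node, TNode.path.injEq, TNode.pend.injEq, reduceCtorEq, left.injEq, right.injEq,
      leftPendant.injEq, rightPendant.injEq, Fin.ext_iff] at h ⊢ <;> omega

theorem mem_node (hi : 1 ≤ i) (hj : 1 ≤ j) (a : TVertex i j) :
    TNode.Mem i j False True a.node := by
  cases a <;> simp only [node, TNode.Mem, imp_false, implies_true, and_true] <;> omega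

theorem exists_node {n : TNode} (h : TNode.Mem i j False True n) :
    ∃ a : TVertex i j, a.node = n := by
  cases n with
  | path k =>
    simp only [TNode.Mem] at h
    rcases lt_trichotomy k 0 with hk | rfl | hk
    · rcases (show k = -i - 2 ∨ k = -i - 1 ∨ -i ≤ k by omega) with rfl | rfl | h1
      · exact ⟨z0, rfl⟩
      · exact ⟨w0, rfl⟩
      · refine ⟨left ⟨(-k - 1).toNat, by omega⟩, ?_⟩
        simp only [node, TNode.path.injEq]
        omega
    · exact ⟨x, rfl⟩
    · rcases (show k = j + 2 ∨ k = j + 1 ∨ k ≤ j by omega) with rfl | rfl | h1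
      · exact ⟨u0, rfl⟩
      · exact ⟨v0, rfl⟩
      · refine ⟨right ⟨(k - 1).toNat, by omega⟩, ?_⟩
        simp only [node, TNode.path.injEq]
        omega
  | pend k =>
    simp only [TNode.Mem, imp_false] at h
    rcases lt_trichotomy k 0 with hk | rfl | hk
    · rcases (show k = -i - 1 ∨ -i < k by omega) with rfl | h1
      · exact ⟨z0', rfl⟩
      · refine ⟨leftPendant ⟨(-k - 1).toNat, by omega⟩, ?_⟩
        simp only [node, TNode.pend.injEq]
        omega
    · exact ⟨y, rfl⟩
    · rcases (show k = j + 1 ∨ k = j ∨ k < j by omega) with rfl | rfl | h1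
      · exact ⟨u0', rfl⟩
      · exact ⟨v', rfl⟩
      · refine ⟨rightPendant ⟨(k - 1).toNat, by omega⟩, ?_⟩
        simp only [node, TNode.pend.injEq]
        omega
  | x0 => exact ⟨x0, rfl⟩
  | y0 => exact ⟨y0, rfl⟩
  | eL => exact ⟨w0', rfl⟩
  | eR => exact ⟨v0', rfl⟩

theorem adj_iff (hi : 1 ≤ i) (hj : 1 ≤ j) (a b : TVertex i j) :
    (bigraphT' i j).graph.Adj a b ↔ TNode.Adj i j a.node b.node := by
  simp only [bigraphT', SimpleGraph.fromRel_adj]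
  cases a <;> cases b <;>
    simp only [Edge, node, TNode.Adj, ne_eq, reduceCtorEq, not_true_eq_false, not_false_eq_true,
      left.injEq, right.injEq, leftPendant.injEq, rightPendant.injEq, Fin.ext_iff, true_and,
      and_false, or_false, false_or, or_true, or_self, and_self,
      true_iff, false_iff] <;> omega

theorem inX_node (a : TVertex i j) : TNode.InX i j a.node ↔ a.side = true := by
  cases a <;> simp only [side, level, node, TNode.InX, decide_eq_true_eq, Nat.even_iff,
    false_iff] <;> first | omega | decide

/-- The left ends of the intervals representing `T'_{i,j}`. -/
def leftEnd : TVertex i j → ℤ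
  | x => 0
  | x0 => 0
  | y0 => 0
  | y => -1
  | left k => -(k + 1)
  | leftPendant k => -(k + 1) - 1
  | w0 => -i - 1
  | w0' => -i - 1
  | z0 => -i - 2
  | z0' => -i - 1
  | right k => k + 1
  | rightPendant k => k + 1
  | v' => j
  | v0 => j + 1
  | v0' => j + 1
  | u0 => j + 2
  | u0' => j + 1

theorem interval_left (a : TVertex i j) : a.interval.left = a.leftEnd := by
  cases a <;> simp [interval, leftEnd, MixedInterval.closed, MixedInterval.opened,
    MixedInterval.closedOpen, MixedInterval.openClosed]

/-- All left ends are integers, so overlapping means having equal left ends and meeting becomes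
integer arithmetic. -/
theorem interval_meets_iff (a b : TVertex i j) :
    a.interval.Meets b.interval ↔ a.leftEnd = b.leftEnd ∨
      (b.leftEnd = a.leftEnd + 1 ∧ a.interval.rightClosed = true ∧
        b.interval.leftClosed = true) ∨
      (a.leftEnd = b.leftEnd + 1 ∧ b.interval.rightClosed = true ∧
        a.interval.leftClosed = true) := by
  rw [MixedInterval.meets_iff, interval_left, interval_left]
  norm_cast
  have : b.leftEnd < a.leftEnd + 1 ∧ a.leftEnd < b.leftEnd + 1 ↔ a.leftEnd = b.leftEnd := by
    omega
  rw [this]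

theorem isRep_interval (hi : 1 ≤ i) (hj : 1 ≤ j) : (bigraphT' i j).IsRep interval := by
  intro a b
  have hs : (bigraphT' i j).side a ≠ (bigraphT' i j).side b ↔
      (TNode.InX i j a.node ↔ ¬ TNode.InX i j b.node) := by
    rw [inX_node, inX_node]
    change a.side ≠ b.side ↔ _
    cases a.side <;> cases b.side <;> decide
  rw [hs, adj_iff hi hj, interval_meets_iff]
  cases a <;> cases b <;>
    simp only [node, TNode.Adj, TNode.InX, leftEnd, interval, MixedInterval.closed,
      MixedInterval.opened, MixedInterval.closedOpen, MixedInterval.openClosed, and_true,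
      and_false, or_false, false_or, reduceCtorEq, and_self, not_true_eq_false,
      not_false_eq_true, iff_true, iff_false, true_iff, false_iff, or_true, true_or] <;> omega

instance : Finite (TVertex i j) := by
  classical
  refine Finite.of_surjective (fun a : Fin 13 ⊕ (Fin i ⊕ Fin (i - 1)) ⊕ Fin j ⊕ Fin (j - 1) =>
    match a with
    | .inl k => (![x, x0, y, y0, w0, w0', z0, z0', v', v0, v0', u0, u0'] k : TVertex i j)
    | .inr (.inl (.inl k)) => left k
    | .inr (.inl (.inr k)) => leftPendant k
    | .inr (.inr (.inl k)) => right k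
    | .inr (.inr (.inr k)) => rightPendant k) fun a => ?_
  cases a with
  | left k => exact ⟨.inr (.inl (.inl k)), rfl⟩
  | leftPendant k => exact ⟨.inr (.inl (.inr k)), rfl⟩
  | right k => exact ⟨.inr (.inr (.inl k)), rfl⟩
  | rightPendant k => exact ⟨.inr (.inr (.inr k)), rfl⟩
  | x => exact ⟨.inl 0, rfl⟩
  | x0 => exact ⟨.inl 1, rfl⟩
  | y => exact ⟨.inl 2, rfl⟩
  | y0 => exact ⟨.inl 3, rfl⟩
  | w0 => exact ⟨.inl 4, rfl⟩
  | w0' => exact ⟨.inl 5, rfl⟩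
  | z0 => exact ⟨.inl 6, rfl⟩
  | z0' => exact ⟨.inl 7, rfl⟩
  | v' => exact ⟨.inl 8, rfl⟩
  | v0 => exact ⟨.inl 9, rfl⟩
  | v0' => exact ⟨.inl 10, rfl⟩
  | u0 => exact ⟨.inl 11, rfl⟩
  | u0' => exact ⟨.inl 12, rfl⟩

/-- Required by `Function.invFun`; its default values at names of absent vertices play no role. -/
instance : Inhabited (TVertex i j) := ⟨x⟩

theorem invFun_node (hi : 1 ≤ i) (hj : 1 ≤ j) (a : TVertex i j) :
    Function.invFun node a.node = a :=
  Function.leftInverse_invFun (node_injective hi hj) a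

theorem node_invFun {n : TNode} (h : TNode.Mem i j False True n) :
    (Function.invFun (node : TVertex i j → TNode) n).node = n :=
  Function.invFun_eq (exists_node h)

theorem node_rep (hi : 1 ≤ i) (hj : 1 ≤ j) {I : TVertex i j → MixedInterval}
    (hI : (bigraphT' i j).IsRep I) :
    TNode.Rep i j False True fun n => I (Function.invFun node n) :=
  hI.node_rep (by omega) (by omega) _ fun n m hn hm => by
    rw [adj_iff hi hj, node_invFun hn, node_invFun hm]

theorem sameOrder (hi : 1 ≤ i) (hj : 1 ≤ j) {I K : TVertex i j → MixedInterval}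
    (hI : TNode.Normal i j False True fun n => I (Function.invFun node n))
    (hK : TNode.Normal i j False True fun n => K (Function.invFun node n)) :
    (bigraphT' i j).SameOrder I K := by
  intro a b hs hab hlt
  have hc : TNode.InX i j a.node ↔ ¬ TNode.InX i j b.node := by
    rw [inX_node, inX_node]
    replace hs : a.side ≠ b.side := hs
    revert hs
    cases a.side <;> cases b.side <;> decide
  rw [adj_iff hi hj] at hab
  rcases (TNode.key_ne hc hab (by omega) (by omega)).lt_or_gt with hk | hk
  · have := hK.prec_of_key_lt (mem_node hi hj a) (mem_node hi hj b) hc hab hk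
    simp only [invFun_node hi hj] at this
    exact this.1
  · have hab' : ¬ TNode.Adj i j b.node a.node := by
      rwa [← adj_iff hi hj, SimpleGraph.adj_comm, adj_iff hi hj]
    have := hI.prec_of_key_lt (mem_node hi hj b) (mem_node hi hj a) (by tauto) hab' hk
    simp only [invFun_node hi hj] at this
    exact absurd this.1 hlt.asymm

theorem normal_interval (hi : 1 ≤ i) (hj : 1 ≤ j) :
    TNode.Normal i j False True fun n =>
      interval (Function.invFun (node : TVertex i j → TNode) n) := by
  refine (node_rep hi hj (isRep_interval hi hj)).normal_of_between ?_ ?_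
  all_goals
    have h0 : Function.invFun (node : TVertex i j → TNode) .x0 = x0 := invFun_node hi hj x0
    rw [h0]
  · have h1 : Function.invFun (node : TVertex i j → TNode) (.path (-1)) = left ⟨0, hi⟩ :=
      invFun_node hi hj (left ⟨0, hi⟩)
    rw [h1]
    simp [MixedInterval.prec_iff, interval, MixedInterval.closed, MixedInterval.opened]
  · have h1 : Function.invFun (node : TVertex i j → TNode) (.path 1) = right ⟨0, hj⟩ :=
      invFun_node hi hj (right ⟨0, hj⟩)
    rw [h1]
    simp [MixedInterval.prec_iff, interval, MixedInterval.closed, MixedInterval.opened]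

theorem isUniqueRep (hi : 1 ≤ i) (hj : 1 ≤ j) : (bigraphT' i j).IsUniqueRep interval := by
  refine ⟨isRep_interval hi hj, fun J hJ => ?_⟩
  rcases (node_rep hi hj hJ).normal_or with h | h
  · exact Bigraph.eqvGen_of_sameOrder (isRep_interval hi hj) hJ
      (sameOrder hi hj (normal_interval hi hj) h)
  -- `J` has the mirrored order, so one reflection is appended.
  · refine .trans _ _ _ (Bigraph.eqvGen_of_sameOrder (isRep_interval hi hj) (hJ.reflect 0)
      (sameOrder hi hj (normal_interval hi hj) h)) (.symm _ _ (.rel _ _ ?_))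
    exact .reflect hJ (hJ.reflect 0) 0 fun v => rfl

theorem interval_of_node_eq_path {a : TVertex i j} {k : ℤ} (h : a.node = .path k) :
    a.interval = .closed k := by
  cases a <;> simp only [node, TNode.path.injEq, reduceCtorEq] at h <;> subst h <;>
    simp [interval]

end TVertex

/-! ### The induced copy of $F_1$. -/

namespace F1Vertex

/-- The position of `F₁` in `T'_{i,j}`. -/
def node : F1Vertex → TNode
  | x1 => .path 0
  | x0 => .x0
  | y0 => .y0
  | y1 => .path (-1)
  | x2 => .path (-2)
  | y2 => .path 1
  | x3 => .path 2
  | y3 => .pend 0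

theorem node_injective : Function.Injective node := by
  intro a b h
  cases a <;> cases b <;> simp [node] at h ⊢

theorem mem_node {i j : ℕ} (hi : 1 ≤ i) (hj : 1 ≤ j) (a : F1Vertex) :
    TNode.Mem i j False True a.node := by
  cases a <;> simp only [node, TNode.Mem, imp_false, implies_true, and_true] <;> omega

theorem adj_iff (i j : ℤ) (a b : F1Vertex) :
    TNode.Adj i j a.node b.node ↔ bigraphF1.graph.Adj a b := by
  simp only [bigraphF1, SimpleGraph.fromRel_adj]
  cases a <;> cases b <;> simp [node, TNode.Adj, Edge]

open TVertex in
theorem interval_invFun_node {i j : ℕ} (hi : 1 ≤ i) (hj : 1 ≤ j) (a : F1Vertex) :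
    TVertex.interval (Function.invFun (TVertex.node : TVertex i j → TNode) a.node) =
      a.interval := by
  have hp (k : ℤ) (hk : TNode.Mem i j False True (.path k)) :
      TVertex.interval (Function.invFun (TVertex.node : TVertex i j → TNode) (.path k)) =
        .closed k :=
    interval_of_node_eq_path (node_invFun hk)
  have hm := a.mem_node hi hj
  cases a with
  | x0 => exact congrArg _ (invFun_node hi hj .x0)
  | y0 => exact congrArg _ (invFun_node hi hj .y0)
  | y3 => exact congrArg _ (invFun_node hi hj .y)
  | _ => exact (hp _ hm).trans (by simp [interval])

/-- The induced copy of `F₁` in `T'_{i,j}`. -/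
noncomputable def embedding {i j : ℕ} (hi : 1 ≤ i) (hj : 1 ≤ j) :
    bigraphF1.graph ↪g (bigraphT' i j).graph where
  toFun a := Function.invFun TVertex.node a.node
  inj' a b h := node_injective <| by
    beta_reduce at h
    rw [← TVertex.node_invFun (a.mem_node hi hj), h, TVertex.node_invFun (b.mem_node hi hj)]
  map_rel_iff' {a b} := by
    change (bigraphT' i j).graph.Adj (Function.invFun TVertex.node a.node)
      (Function.invFun TVertex.node b.node) ↔ _
    rw [TVertex.adj_iff hi hj, TVertex.node_invFun (a.mem_node hi hj),
      TVertex.node_invFun (b.mem_node hi hj), adj_iff]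

end F1Vertex

/-! ### The bigraph $T_{i,j}$ and the main statement. -/

/-- The vertex of `T_{i,j}` with a given name. -/
noncomputable def tOfNode (i j : ℕ) : TNode → Option (TVertex i j)
  | .pend k => if k = -i then none else some (Function.invFun TVertex.node (.pend k))
  | n => some (Function.invFun TVertex.node n)

theorem tOfNode_cases {i j : ℕ} {n : TNode} (hn : TNode.Mem i j True True n) :
    (n = .pend (-i) ∧ tOfNode i j n = none) ∨ ∃ a : TVertex i j, a.node = n ∧
      tOfNode i j n = some a := by
  cases n with
  | pend k =>
    by_cases hk : k = -i
    · exact Or.inl ⟨by rw [hk], if_pos hk⟩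
    · exact Or.inr ⟨_, TVertex.node_invFun ⟨hn.1, hn.2.1, hk, hn.2.2.2⟩, if_neg hk⟩
  | path k => exact Or.inr ⟨_, TVertex.node_invFun hn, rfl⟩
  | _ => exact Or.inr ⟨_, TVertex.node_invFun trivial, rfl⟩

theorem bigraphT_adj_some {i j : ℕ} (a b : TVertex i j) :
    (bigraphT i j).graph.Adj (some a) (some b) ↔ (bigraphT' i j).graph.Adj a b := by
  simp [bigraphT, bigraphT', SimpleGraph.fromRel_adj, TEdge]

theorem bigraphT_adj_none {i j : ℕ} (hi : 1 ≤ i) (hj : 1 ≤ j) (a : TVertex i j) :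
    (bigraphT i j).graph.Adj (some a) none ↔ TNode.Adj i j a.node (.pend (-i)) := by
  simp only [bigraphT, SimpleGraph.fromRel_adj, TEdge]
  cases a <;> simp only [TVertex.node, TNode.Adj, ne_eq, reduceCtorEq, not_false_eq_true,
    or_false, true_and, and_false, false_iff] <;> omega

theorem bigraphT_adj_tOfNode {i j : ℕ} (hi : 1 ≤ i) (hj : 1 ≤ j) {n m : TNode}
    (hn : TNode.Mem i j True True n) (hm : TNode.Mem i j True True m) :
    (bigraphT i j).graph.Adj (tOfNode i j n) (tOfNode i j m) ↔ TNode.Adj i j n m := by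
  rcases tOfNode_cases hn with ⟨rfl, e1⟩ | ⟨a, rfl, e1⟩ <;>
    rcases tOfNode_cases hm with ⟨rfl, e2⟩ | ⟨b, rfl, e2⟩ <;>
    simp only [e1, e2]
  · simp [TNode.Adj]
  · rw [SimpleGraph.adj_comm, bigraphT_adj_none hi hj]
    cases b <;> simp only [TVertex.node, TNode.Adj, eq_comm]
  · exact bigraphT_adj_none hi hj a
  · rw [bigraphT_adj_some, TVertex.adj_iff hi hj]

theorem lemma7 (i j : ℕ) (hi : 1 ≤ i) (hj : 1 ≤ j) :
    ((bigraphT' i j).IsUniqueRep TVertex.interval ∧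
      ∃ e : bigraphF1.graph ↪g (bigraphT' i j).graph,
        ∀ a, TVertex.interval (e a) = F1Vertex.interval a) ∧
    ∀ (V : Type u) (B : Bigraph V), B.IsMixedUnitIntervalBigraph →
      ¬ (bigraphT i j).graph.IsIndContained B.graph := by
  refine ⟨⟨TVertex.isUniqueRep hi hj, F1Vertex.embedding hi hj,
    F1Vertex.interval_invFun_node hi hj⟩, ?_⟩
  rintro V B ⟨I, hI⟩ ⟨e⟩
  -- Both optional pendants are present here: $w'$ at the left end and $v'$ at the right end.
  have h := hI.node_rep (i := i) (j := j) (pL := True) (pR := True) (by omega) (by omega)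
    (fun n => e (tOfNode i j n)) fun n m hn hm => by
      rw [e.map_adj_iff, bigraphT_adj_tOfNode hi hj hn hm]
  rcases h.normal_or with h | h <;> exact h.not_both
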